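/- **Energy conservation on the continuous level.** Let $d\in\{2,3\}$, let $\Omega\subset\mathbb R^d$ be bounded and open (fluid and solid together), $\Omega^s_{\mathbf X}\subset\mathbb R^d$ open (reference domain of the solid), $T>0$, $\rho^f,\rho^s,\nu^f,\nu^s\in\mathbb R$, $\rho^\delta=\rho^s-\rho^f$, $\nu^\delta=\nu^s-\nu^f$, and let $\Psi\in C^1(\mathbb R^{d\times d})$ be the solid energy function, with $\mathbf P_{ij}=\partial\Psi/\partial\mathbf F_{ij}$. Write $(\nabla\mathbf v)_{ij}=\partial_j v_i$, $\mathrm D\mathbf v=\nabla\mathbf v+\nabla^{\mathrm T}\mathbf v$ and $\mathbf A:\mathbf B=\sum_{i,j}A_{ij}B_{ij}$. Let $\mathbf x(t):\Omega^s_{\mathbf X}\to\Omega$, $t\in[0,T]$, be the motion of the solid, with $c_0\|\mathbf X-\mathbf Y\|\le\|\mathbf x(\mathbf X,t)-\mathbf x(\mathbf Y,t)\|\le L\|\mathbf X-\mathbf Y\|$ for constants $c_0>0$ and $L$ independent of $t$. Put $\Omega^s_t=\mathbf x(t)(\Omega^s_{\mathbf X})$ and $\mathbf F=\partial\mathbf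 x/\partial\mathbf X$. Let $(\mathbf u,p)$ be a solution of the one-field weak form, that is: * $\mathbf u\in H^1(0,T;L^2(\Omega)^d)$ (continuous representative in time) with time derivative $\partial_t\mathbf u$; $\mathbf u(t)\in H^1_0(\Omega)^d$ and $p(t)\in L^2_0(\Omega)$ (the space of functions in $L^2(\Omega)$ of zero mean) for a.e. $t$; and $\nabla\mathbf u\in L^2((0,T)\times\Omega)$. * The solid moves with its own velocity: $\mathbf x\in H^1(0,T;L^2(\Omega^s_{\mathbf X})^d)$ with $\partial_t\mathbf x(\mathbf X,t)=\mathbf u(\mathbf x(\mathbf X,t),t)$; and the function $(\mathbf X,t)\mapsto\mathbf u(\mathbf x(\mathbf X,t),t)$ is in $H^1(0,T;L^2(\Omega^s_{\mathbf X})^d)$, its time derivative being $\frac{d\mathbf u}{dt}(\mathbf x(\mathbf X,t),t)$ (the material derivative). * For a.e. $t\in(0,T)$, for all $\mathbf v\in H^1_0(\Omega)^d$, with $\nabla_{\mathbf X}\mathbf v$ the weak gradient of $\mathbf v\circ\mathbf x(t)$ on $\Omega^s_{\mathbf X}$, $$\rho^f\int_\Omega\partial_t\mathbf u\cdot\mathbf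 v\,d\mathbf x+\rho^f\int_\Omega(\mathbf u\cdot\nabla)\mathbf u\cdot\mathbf v\,d\mathbf x+\frac{\nu^f}2\int_\Omega\mathrm D\mathbf u:\mathrm D\mathbf v\,d\mathbf x-\int_\Omega p\,\nabla\cdot\mathbf v\,d\mathbf x+\rho^\delta\int_{\Omega^s_t}\frac{d\mathbf u}{dt}\cdot\mathbf v\,d\mathbf x+\frac{\nu^\delta}2\int_{\Omega^s_t}\mathrm D\mathbf u:\mathrm D\mathbf v\,d\mathbf x+\int_{\Omega^s_{\mathbf X}}\mathbf P(\mathbf F):\nabla_{\mathbf X}\mathbf v\,d\mathbf X=0,$$ and $-\int_\Omega q\,\nabla\cdot\mathbf u\,d\mathbf x=0$ for all $q\in L^2(\Omega)$. Then, for every $t\in[0,T]$, $\Psi(\mathbf F(t))$ is integrable on $\Omega^s_{\mathbf X}$ and $$\begin{aligned}&\frac{\rho^f}2\int_\Omega|\mathbf u(t)|^2d\mathbf x+\frac{\nu^f}2\int_0^t\!\int_\Omega\mathrm D\mathbf u:\mathrm D\mathbf u\,d\mathbf x\,ds+\frac{\rho^\delta}2\int_{\Omega^s_t}|\mathbf u(t)|^2d\mathbf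 x+\frac{\nu^\delta}2\int_0^t\!\int_{\Omega^s_s}\mathrm D\mathbf u:\mathrm D\mathbf u\,d\mathbf x\,ds+\int_{\Omega^s_{\mathbf X}}\Psi(\mathbf F(t))\,d\mathbf X\\&\qquad=E_0:=\frac{\rho^f}2\int_\Omega|\mathbf u(0)|^2d\mathbf x+\frac{\rho^\delta}2\int_{\Omega^s_0}|\mathbf u(0)|^2d\mathbf x+\int_{\Omega^s_{\mathbf X}}\Psi(\mathbf F(0))\,d\mathbf X.\end{aligned}$$ In particular, if the initial energy $E_0$ is zero, the left-hand side is zero for every $t\in[0,T]$. -/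

import Mathlib

open MeasureTheory Set Filter Topology
open scoped ContDiff Matrix

attribute [local instance] Matrix.normedAddCommGroup Matrix.normedSpace

noncomputable section

namespace FSI

/-- Vectors of `ℝ^d` with the Euclidean norm. -/
abbrev Vec (d : ℕ) : Type := EuclideanSpace ℝ (Fin d)

/-- Second order tensors. The gradient convention is `(∇ v) i j = ∂ v_i / ∂ x_j`. -/
abbrev Tensor (d : ℕ) : Type := Matrix (Fin d) (Fin d) ℝ

/-- The double contraction `A : B = ∑ i j, A i j * B i j`. -/
def ddot {d : ℕ} (A B : Tensor d) : ℝ := ∑ i, ∑ j, A i j * B i j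

/-- The classical gradient (Jacobian matrix) of a vector field. -/
def jacobian {d : ℕ} (f : Vec d → Vec d) (y : Vec d) : Tensor d :=
  Matrix.of fun i j => (fderiv ℝ f y (EuclideanSpace.single j 1)) i

/-- `Du = ∇u + (∇u)ᵀ`, as a function of the velocity gradient `G = ∇u`. -/
def symGrad {d : ℕ} (G : Tensor d) : Tensor d := G + Gᵀ

/-- `G` is the weak gradient of the vector field `v` on the open set `U`. -/
def HasWeakGradient {d : ℕ} (U : Set (Vec d)) (v : Vec d → Vec d) (G : Vec d → Tensor d) : Prop :=
  ∀ φ : Vec d → ℝ, ContDiff ℝ ∞ φ → HasCompactSupport φ → tsupport φ ⊆ U → ∀ i j : Fin d,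
    ∫ y in U, v y i * fderiv ℝ φ y (EuclideanSpace.single j 1) = -∫ y in U, G y i j * φ y

/-- `v ∈ H¹(U)^d` with weak gradient `G`. -/
structure MemH1 {d : ℕ} (U : Set (Vec d)) (v : Vec d → Vec d) (G : Vec d → Tensor d) : Prop where
  memLp : MemLp v 2 (volume.restrict U)
  memLp_grad : ∀ i j, MemLp (fun y => G y i j) 2 (volume.restrict U)
  weakGradient : HasWeakGradient U v G

/-- `v ∈ H¹₀(U)^d` with weak gradient `G`: membership in the closure of the smooth vector fields
with compact support in `U`, for the `H¹(U)` norm. -/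
structure MemH10 {d : ℕ} (U : Set (Vec d)) (v : Vec d → Vec d) (G : Vec d → Tensor d) : Prop
    extends MemH1 U v G where
  approx : ∃ φ : ℕ → Vec d → Vec d,
    (∀ n, ContDiff ℝ ∞ (φ n) ∧ HasCompactSupport (φ n) ∧ tsupport (φ n) ⊆ U) ∧
    Tendsto (fun n => eLpNorm (fun y => φ n y - v y) 2 (volume.restrict U)) atTop (𝓝 0) ∧
    ∀ i j, Tendsto (fun n => eLpNorm (fun y => jacobian (φ n) y i j - G y i j) 2
      (volume.restrict U)) atTop (𝓝 0)

/-- `p ∈ L²₀(U)`: square integrable with zero mean. -/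
structure MemL20 {d : ℕ} (U : Set (Vec d)) (p : Vec d → ℝ) : Prop where
  memLp : MemLp p 2 (volume.restrict U)
  mean_zero : ∫ y in U, p y = 0

/-- `w ∈ H¹(0, T; L²(U)^d)` with time derivative `wt ∈ L²(0, T; L²(U)^d)`: the continuous
representative of `w` is the primitive of `wt`. -/
structure HasTimeDerivative {d : ℕ} (T : ℝ) (U : Set (Vec d)) (w wt : ℝ → Vec d → Vec d) :
    Prop where
  memLp : ∀ t ∈ Icc 0 T, MemLp (w t) 2 (volume.restrict U)
  memLp_deriv : MemLp (fun z : ℝ × Vec d => wt z.1 z.2) 2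
    ((volume.restrict (Icc 0 T)).prod (volume.restrict U))
  eq_primitive : ∀ t ∈ Icc 0 T, ∀ᵐ y ∂(volume.restrict U), w t y = w 0 y + ∫ s in 0..t, wt s y

/-- The first Piola-Kirchhoff stress `P i j = ∂Ψ / ∂F i j`. -/
def piolaKirchhoff {d : ℕ} (Ψ : Tensor d → ℝ) (F : Tensor d) : Tensor d :=
  Matrix.of fun i j => fderiv ℝ Ψ F (Matrix.single i j 1)

/-- The data of the fluid-structure interaction problem on the time interval `[0, T]`. -/
structure Data (d : ℕ) where
  /-- the fixed domain occupied by fluid and solid together -/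
  Ω : Set (Vec d)
  isOpen_Ω : IsOpen Ω
  bounded_Ω : Bornology.IsBounded Ω
  /-- the reference domain of the solid -/
  ΩX : Set (Vec d)
  isOpen_ΩX : IsOpen ΩX
  /-- final time -/
  T : ℝ
  T_pos : 0 < T
  /-- density of the fluid -/
  ρf : ℝ
  /-- density of the solid -/
  ρs : ℝ
  /-- viscosity of the fluid -/
  νf : ℝ
  /-- viscosity of the solid -/
  νs : ℝ
  /-- energy function of the hyperelastic solid -/
  Ψ : Tensor d → ℝ
  contDiff_Ψ : ContDiff ℝ 1 Ψ

namespace Data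

variable {d : ℕ} (D : Data d)

/-- `ρ^δ = ρ^s - ρ^f` -/
def ρδ : ℝ := D.ρs - D.ρf

/-- `ν^δ = ν^s - ν^f` -/
def νδ : ℝ := D.νs - D.νf

/-- The region occupied by the solid at time `t`, for the motion `x`. -/
def solid (x : ℝ → Vec d → Vec d) (t : ℝ) : Set (Vec d) := x t '' D.ΩX

/-- The motion `x` of the solid: at each time a bi-Lipschitz map of the reference domain into `Ω`,
with constants uniform in time. -/
structure IsMotion (x : ℝ → Vec d → Vec d) : Prop where
  mapsTo : ∀ t ∈ Icc 0 D.T, MapsTo (x t) D.ΩX D.Ω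
  lipschitz : ∃ L : ℝ, ∀ t ∈ Icc 0 D.T, ∀ X ∈ D.ΩX, ∀ Y ∈ D.ΩX, ‖x t X - x t Y‖ ≤ L * ‖X - Y‖
  lipschitz_inverse : ∃ c₀ : ℝ, 0 < c₀ ∧
    ∀ t ∈ Icc 0 D.T, ∀ X ∈ D.ΩX, ∀ Y ∈ D.ΩX, c₀ * ‖X - Y‖ ≤ ‖x t X - x t Y‖

/-- The momentum equation at one instant, tested with `v`, where `Gv` is the gradient of `v` and
`Hv` its gradient `∇_X v` in the reference coordinates of the solid. Here `u` is the velocity, `Gu`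
its gradient, `ut` its time derivative at fixed points of `Ω`, `a` its time derivative along the
motion of the solid, `p` the pressure, `xt` the current position map of the solid. -/
def MomentumEq (u ut a : Vec d → Vec d) (Gu : Vec d → Tensor d) (p : Vec d → ℝ)
    (xt : Vec d → Vec d) (v : Vec d → Vec d) (Gv Hv : Vec d → Tensor d) : Prop :=
  D.ρf * (∫ y in D.Ω, inner ℝ (ut y) (v y))
    + D.ρf * (∫ y in D.Ω, ∑ i, ∑ j, u y j * Gu y i j * v y i)
    + D.νf / 2 * (∫ y in D.Ω, ddot (symGrad (Gu y)) (symGrad (Gv y)))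
    - (∫ y in D.Ω, p y * (Gv y).trace)
    + D.ρδ * (∫ y in xt '' D.ΩX, inner ℝ (a y) (v y))
    + D.νδ / 2 * (∫ y in xt '' D.ΩX, ddot (symGrad (Gu y)) (symGrad (Gv y)))
    + (∫ X in D.ΩX, ddot (piolaKirchhoff D.Ψ (jacobian xt X)) (Hv X)) = 0

/-- `(u, p)` solves the one-field weak form of the fluid-structure interaction problem, the solid
moving by `x`. The fields `Gu`, `ut`, `a` are the derivatives of `u`: its weak gradient, its time
derivative at fixed points of `Ω`, and its time derivative following the solid. -/
structure IsWeakSolution (u : ℝ → Vec d → Vec d) (p : ℝ → Vec d → ℝ) (x : ℝ → Vec d → Vec d)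
    (Gu : ℝ → Vec d → Tensor d) (ut a : ℝ → Vec d → Vec d) : Prop where
  motion : D.IsMotion x
  /-- the solid is carried by its own velocity -/
  kinematic : HasTimeDerivative D.T D.ΩX x (fun t X => u t (x t X))
  timeDerivative : HasTimeDerivative D.T D.Ω u ut
  materialDerivative :
    HasTimeDerivative D.T D.ΩX (fun t X => u t (x t X)) (fun t X => a t (x t X))
  gradient_memLp : ∀ i j, MemLp (fun z : ℝ × Vec d => Gu z.1 z.2 i j) 2
    ((volume.restrict (Icc 0 D.T)).prod (volume.restrict D.Ω))
  velocity_mem : ∀ᵐ t ∂(volume.restrict (Icc 0 D.T)), MemH10 D.Ω (u t) (Gu t)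
  pressure_mem : ∀ᵐ t ∂(volume.restrict (Icc 0 D.T)), MemL20 D.Ω (p t)
  momentum : ∀ᵐ t ∂(volume.restrict (Icc 0 D.T)),
    ∀ (v : Vec d → Vec d) (Gv Hv : Vec d → Tensor d), MemH10 D.Ω v Gv →
      MemH1 D.ΩX (fun X => v (x t X)) Hv →
      D.MomentumEq (u t) (ut t) (a t) (Gu t) (p t) (x t) v Gv Hv
  incompressible : ∀ᵐ t ∂(volume.restrict (Icc 0 D.T)),
    ∀ q : Vec d → ℝ, MemLp q 2 (volume.restrict D.Ω) → -∫ y in D.Ω, q y * (Gu t y).trace = 0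

/-- Kinetic energy in `Ω` at time `t`. -/
def kineticΩ (u : ℝ → Vec d → Vec d) (t : ℝ) : ℝ :=
  D.ρf / 2 * ∫ y in D.Ω, ‖u t y‖ ^ 2

/-- Extra kinetic energy in the solid region at time `t`. -/
def kineticSolid (u x : ℝ → Vec d → Vec d) (t : ℝ) : ℝ :=
  D.ρδ / 2 * ∫ y in D.solid x t, ‖u t y‖ ^ 2

/-- Viscous dissipation in `Ω` up to time `t`. -/
def dissipationΩ (Gu : ℝ → Vec d → Tensor d) (t : ℝ) : ℝ :=
  D.νf / 2 * ∫ s in 0..t, ∫ y in D.Ω, ddot (symGrad (Gu s y)) (symGrad (Gu s y))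

/-- Extra viscous dissipation in the solid region up to time `t`. -/
def dissipationSolid (Gu : ℝ → Vec d → Tensor d) (x : ℝ → Vec d → Vec d) (t : ℝ) : ℝ :=
  D.νδ / 2 * ∫ s in 0..t, ∫ y in D.solid x s, ddot (symGrad (Gu s y)) (symGrad (Gu s y))

/-- Potential energy of the solid at time `t`, with deformation tensor `F = ∂x / ∂X`. -/
def potential (x : ℝ → Vec d → Vec d) (t : ℝ) : ℝ :=
  ∫ X in D.ΩX, D.Ψ (jacobian (x t) X)

end Data

end FSI

end

/-!
The velocity `u(t)` is an admissible test function in the momentum equation, and testing with it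
gives the balance of power (`FSI.Data.IsWeakSolution.ae_power_balance`); integrating this balance
in time gives the conservation of energy (`FSI.Data.IsWeakSolution.energy_eq`).

* *Admissibility.* The momentum equation requires `u(t) ∘ x(t) ∈ H¹`. As `x(t)` is bi-Lipschitz,
  composition with it is bounded from `L²(Ω)` to `L²` of the reference domain, and the chain rule
  `∇_X u = (∇u ∘ x) F` passes to the limit from smooth fields, whose compositions with `x(t)` are
  Lipschitz (`FSI.MemH10.comp_biLip`).
* *Terms that vanish.* The pressure term vanishes since `div u = 0`. For the convective term, the
  squares `|φ|²` of smooth approximants `φ` of `u` are tested against `div u = 0`, which gives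
  `∫ (u · ∇) φ · φ = 0`. By the Sobolev inequality, `φ → u` in `L⁴`, and the limit
  `∫ (u · ∇) u · u = 0` can be taken (`FSI.MemH10.integral_convective_eq_zero`).
* *Time derivatives.* A function in `H¹(0, T; L²)` has a representative that is absolutely
  continuous in time at almost every point of space. The chain rule holds along these curves, and
  Fubini's theorem integrates it over space (`FSI.integral_sub_eq_integral_fderiv`). With `Φ = |·|²` this is
  the rate of change of the kinetic energy in `Ω`.
* *Deformation gradient.* Taking the weak gradient of `x(t) = x(0) + ∫₀ᵗ u ∘ x ds` gives
  `F(t) = F(0) + ∫₀ᵗ ∇_X u ds` (`FSI.Data.IsWeakSolution.jacobian_eq_primitive`). Hence the power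
  `∫ P(F) : ∇_X u` of the elastic stress is the rate of change of the potential energy, by the chain
  rule with `Φ = Ψ`. By Jacobi's formula, `∂ₜ det F = (div u ∘ x) det F = 0`
  (`FSI.Data.IsWeakSolution.det_jacobian_eq`). The volume element of the motion thus does not depend
  on time, and the kinetic energy of the solid is an integral over the reference domain with a fixed
  weight, to which the chain rule applies once more.

Measurability in time needs some care, since neither `x` nor `F` is assumed jointly measurable.
Jointly measurable representatives are the primitive `x(0) + ∫₀ᵗ u ∘ x ds` for `x`, and the upper
limit of its difference quotients for `F` (`FSI.exists_measurable_jacobian`).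
-/

namespace FSI

open scoped ENNReal NNReal

variable {d : ℕ}

/-! ### Bi-Lipschitz maps -/

/-- Lipschitz maps increase the volume at most by the factor `K ^ d`: the volume is a multiple of
the Hausdorff measure. -/
lemma volume_image_le_of_lipschitzOnWith {g : Vec d → Vec d} {K : ℝ≥0} {s : Set (Vec d)}
    (hg : LipschitzOnWith K g s) : volume (g '' s) ≤ (K : ℝ≥0∞) ^ d * volume s := by
  have hH : (Measure.hausdorffMeasure (d : ℝ) : Measure (Vec d)).IsAddHaarMeasure := by
    have := isAddHaarMeasure_hausdorffMeasure (E := Vec d)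
    rwa [finrank_euclideanSpace, Fintype.card_fin] at this
  have h := Measure.isAddLeftInvariant_eq_smul (volume : Measure (Vec d))
    (Measure.hausdorffMeasure (d : ℝ))
  have h1 := hg.hausdorffMeasure_image_le (d := d) (Nat.cast_nonneg d)
  rw [ENNReal.rpow_natCast] at h1
  rw [h, Measure.smul_apply, Measure.smul_apply, ENNReal.smul_def, smul_eq_mul, ENNReal.smul_def,
    smul_eq_mul, mul_left_comm]
  gcongr

lemma volume_inter_preimage_le {f : Vec d → Vec d} {K : ℝ≥0} {U : Set (Vec d)}
    (hK : ∀ X ∈ U, ∀ Y ∈ U, dist X Y ≤ K * dist (f X) (f Y)) (A : Set (Vec d)) :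
    volume (U ∩ f ⁻¹' A) ≤ (K : ℝ≥0∞) ^ d * volume A := by
  have hinj : InjOn f U := fun X hX Y hY hXY => by
    have := hK X hX Y hY
    rw [hXY, dist_self, mul_zero] at this
    exact dist_le_zero.1 this
  have hlip : LipschitzOnWith K (Function.invFunOn f U) (f '' U ∩ A) := by
    apply LipschitzOnWith.of_dist_le_mul
    rintro _ ⟨⟨X, hX, rfl⟩, -⟩ _ ⟨⟨Y, hY, rfl⟩, -⟩
    rw [hinj.leftInvOn_invFunOn hX, hinj.leftInvOn_invFunOn hY]
    exact hK X hX Y hY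
  have hsub : U ∩ f ⁻¹' A ⊆ Function.invFunOn f U '' (f '' U ∩ A) := fun X hX =>
    ⟨f X, ⟨mem_image_of_mem f hX.1, hX.2⟩, hinj.leftInvOn_invFunOn hX.1⟩
  calc volume (U ∩ f ⁻¹' A) ≤ volume (Function.invFunOn f U '' (f '' U ∩ A)) := measure_mono hsub
    _ ≤ (K : ℝ≥0∞) ^ d * volume (f '' U ∩ A) := volume_image_le_of_lipschitzOnWith hlip
    _ ≤ _ := by gcongr; exact inter_subset_right

/-- A bi-Lipschitz map of the open set `U` into the measurable set `Ω`. The constant `K` is a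
Lipschitz constant of the inverse. -/
structure BiLip (L K : ℝ≥0) (U Ω : Set (Vec d)) (f : Vec d → Vec d) : Prop where
  isOpen : IsOpen U
  measurableSet : MeasurableSet Ω
  mapsTo : MapsTo f U Ω
  lipschitz : LipschitzOnWith L f U
  dist_le : ∀ X ∈ U, ∀ Y ∈ U, dist X Y ≤ K * dist (f X) (f Y)

lemma abs_jacobian_apply_le {L : ℝ≥0} {U : Set (Vec d)} {f : Vec d → Vec d} (hU : IsOpen U)
    (hf : LipschitzOnWith L f U) {X : Vec d} (hX : X ∈ U) (i j : Fin d) :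
    |jacobian f X i j| ≤ L := by
  have h1 : ‖fderiv ℝ f X‖ ≤ L := norm_fderiv_le_of_lipschitzOn ℝ (hU.mem_nhds hX) hf
  have h2 := PiLp.norm_apply_le (fderiv ℝ f X (EuclideanSpace.single j 1)) i
  have h3 := (fderiv ℝ f X).le_opNorm (EuclideanSpace.single j 1)
  simp only [PiLp.norm_single, norm_one, mul_one] at h3
  exact (h2.trans h3).trans h1

lemma norm_jacobian_le {L : ℝ≥0} {U : Set (Vec d)} {f : Vec d → Vec d} (hU : IsOpen U)
    (hf : LipschitzOnWith L f U) {X : Vec d} (hX : X ∈ U) : ‖jacobian f X‖ ≤ L :=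
  (Matrix.norm_le_iff L.2).2 fun i j => abs_jacobian_apply_le hU hf hX i j

lemma measurable_jacobian_apply (f : Vec d → Vec d) (i j : Fin d) :
    Measurable fun X => jacobian f X i j := by
  have := (measurable_fderiv_apply_const ℝ f (EuclideanSpace.single j (1 : ℝ)))
  exact (EuclideanSpace.proj (𝕜 := ℝ) i).continuous.measurable.comp this

lemma eq_sum_smul_single (w : Vec d) : w = ∑ k, w k • EuclideanSpace.single k (1 : ℝ) := by
  ext l; simp [Pi.single_apply]

lemma jacobian_comp {f φ : Vec d → Vec d} {X : Vec d} (hφ : DifferentiableAt ℝ φ (f X))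
    (hf : DifferentiableAt ℝ f X) :
    jacobian (fun Y => φ (f Y)) X = jacobian φ (f X) * jacobian f X := by
  ext i j
  have h : fderiv ℝ (fun Y => φ (f Y)) X = (fderiv ℝ φ (f X)).comp (fderiv ℝ f X) :=
    fderiv_comp X hφ hf
  simp only [jacobian, Matrix.mul_apply, Matrix.of_apply, h, ContinuousLinearMap.comp_apply]
  conv_lhs => rw [eq_sum_smul_single (fderiv ℝ f X (EuclideanSpace.single j 1))]
  simp [map_sum, mul_comm]

lemma det_fderiv_eq (f : Vec d → Vec d) (X : Vec d) :
    (fderiv ℝ f X).det = (jacobian f X).det := by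
  have h := LinearMap.det_toMatrix (EuclideanSpace.basisFun (Fin d) ℝ).toBasis
    (fderiv ℝ f X : Vec d →ₗ[ℝ] Vec d)
  rw [ContinuousLinearMap.det, ← h]
  congr 1

namespace BiLip

variable {L K : ℝ≥0} {U Ω : Set (Vec d)} {f : Vec d → Vec d}

lemma injOn (h : BiLip L K U Ω f) : InjOn f U := fun X hX Y hY hXY => by
  have := h.dist_le X hX Y hY
  rw [hXY, dist_self, mul_zero] at this
  exact dist_le_zero.1 this

lemma aemeasurable (h : BiLip L K U Ω f) : AEMeasurable f (volume.restrict U) :=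
  h.lipschitz.continuousOn.aemeasurable h.isOpen.measurableSet

/-- The preimage of a set under `f` is its image by the Lipschitz inverse, and has at most `K ^ d`
times its volume. Composition with `f` is therefore bounded on `L²`. -/
lemma map_le (h : BiLip L K U Ω f) :
    (volume.restrict U).map f ≤ ((K : ℝ≥0∞) ^ d) • volume.restrict Ω := by
  refine Measure.le_iff.2 fun A hA => ?_
  rw [Measure.map_apply_of_aemeasurable h.aemeasurable hA, Measure.smul_apply, smul_eq_mul,
    Measure.restrict_apply hA, Measure.restrict_apply' h.isOpen.measurableSet]
  have : f ⁻¹' A ∩ U = U ∩ f ⁻¹' (A ∩ Ω) := by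
    ext X; constructor
    · exact fun hX => ⟨hX.2, hX.1, h.mapsTo hX.2⟩
    · exact fun hX => ⟨hX.2.1, hX.1⟩
  rw [this]
  exact volume_inter_preimage_le h.dist_le _

lemma map_absolutelyContinuous (h : BiLip L K U Ω f) :
    (volume.restrict U).map f ≪ volume.restrict Ω :=
  (Measure.absolutelyContinuous_of_le_smul h.map_le)

lemma ae_comp (h : BiLip L K U Ω f) {P : Vec d → Prop} (hP : ∀ᵐ y ∂(volume.restrict Ω), P y) :
    ∀ᵐ X ∂(volume.restrict U), P (f X) :=
  ae_of_ae_map h.aemeasurable (h.map_absolutelyContinuous.ae_le hP)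

lemma aestronglyMeasurable_comp (h : BiLip L K U Ω f) {E : Type*} [NormedAddCommGroup E]
    {g : Vec d → E} (hg : AEStronglyMeasurable g (volume.restrict Ω)) :
    AEStronglyMeasurable (fun X => g (f X)) (volume.restrict U) :=
  (hg.mono_ac h.map_absolutelyContinuous).comp_aemeasurable h.aemeasurable

lemma eLpNorm_comp_le (h : BiLip L K U Ω f) {E : Type*} [NormedAddCommGroup E]
    {g : Vec d → E} (hg : AEStronglyMeasurable g (volume.restrict Ω)) :
    eLpNorm (fun X => g (f X)) 2 (volume.restrict U)
      ≤ ((K : ℝ≥0∞) ^ d) ^ (1 / 2 : ℝ) * eLpNorm g 2 (volume.restrict Ω) := by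
  have h1 : eLpNorm (fun X => g (f X)) 2 (volume.restrict U)
      = eLpNorm g 2 ((volume.restrict U).map f) :=
    (eLpNorm_map_measure (hg.mono_ac h.map_absolutelyContinuous) h.aemeasurable).symm
  rw [h1]
  refine (eLpNorm_mono_measure g h.map_le).trans ?_
  rw [eLpNorm_smul_measure_of_ne_top (by simp)]
  simp

lemma memLp_comp (h : BiLip L K U Ω f) {E : Type*} [NormedAddCommGroup E]
    {g : Vec d → E} (hg : MemLp g 2 (volume.restrict Ω)) :
    MemLp (fun X => g (f X)) 2 (volume.restrict U) :=
  ⟨h.aestronglyMeasurable_comp hg.1, (h.eLpNorm_comp_le hg.1).trans_lt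
    (ENNReal.mul_lt_top (ENNReal.rpow_lt_top_of_nonneg (by norm_num) (by simp)) hg.2)⟩

lemma tendsto_eLpNorm_comp (h : BiLip L K U Ω f) {E : Type*} [NormedAddCommGroup E]
    {g : ℕ → Vec d → E} (hg : ∀ n, AEStronglyMeasurable (g n) (volume.restrict Ω))
    (hlim : Tendsto (fun n => eLpNorm (g n) 2 (volume.restrict Ω)) atTop (𝓝 0)) :
    Tendsto (fun n => eLpNorm (fun X => g n (f X)) 2 (volume.restrict U)) atTop (𝓝 0) := by
  have hC : ((K : ℝ≥0∞) ^ d) ^ (1 / 2 : ℝ) ≠ ⊤ :=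
    (ENNReal.rpow_lt_top_of_nonneg (by norm_num) (by simp)).ne
  have h1 := ENNReal.Tendsto.const_mul hlim (Or.inr hC)
  rw [mul_zero] at h1
  exact tendsto_of_tendsto_of_tendsto_of_le_of_le tendsto_const_nhds h1 (fun _ => zero_le)
    fun n => h.eLpNorm_comp_le (hg n)

lemma ae_differentiableAt (h : BiLip L K U Ω f) :
    ∀ᵐ X ∂(volume.restrict U), DifferentiableAt ℝ f X := by
  rw [ae_restrict_iff' h.isOpen.measurableSet]
  filter_upwards [h.lipschitz.ae_differentiableWithinAt_of_mem (μ := volume)] with X hX hXU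
  exact (hX hXU).differentiableAt (h.isOpen.mem_nhds hXU)

/-- The area formula for bi-Lipschitz maps. The points of non-differentiability are negligible, and
so is their image. -/
lemma setIntegral_image (h : BiLip L K U Ω f) (g : Vec d → ℝ) :
    ∫ y in f '' U, g y = ∫ X in U, |(jacobian f X).det| * g (f X) := by
  set S : Set (Vec d) := U ∩ {X | DifferentiableAt ℝ f X} with hS
  have hSm : MeasurableSet S :=
    h.isOpen.measurableSet.inter (measurableSet_of_differentiableAt ℝ f)
  have hnull : volume (U \ S) = 0 := by
    have := h.ae_differentiableAt
    rw [ae_restrict_iff' h.isOpen.measurableSet, ae_iff] at this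
    refine measure_mono_null ?_ this
    intro X hX
    simp only [mem_ofPred_eq, Classical.not_imp]
    exact ⟨hX.1, fun hd => hX.2 ⟨hX.1, hd⟩⟩
  have hnull' : volume (f '' (U \ S)) = 0 := by
    have := volume_image_le_of_lipschitzOnWith (h.lipschitz.mono (sdiff_subset (s := U) (t := S)))
    rw [hnull, mul_zero] at this
    exact le_antisymm this zero_le
  have hSU : S =ᵐ[volume] U := by
    refine (ae_eq_set).2 ⟨?_, hnull⟩
    rw [sdiff_eq_empty.2 inter_subset_left, measure_empty]
  have himg : f '' S =ᵐ[volume] f '' U := by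
    refine (ae_eq_set).2 ⟨?_, measure_mono_null ?_ hnull'⟩
    · rw [sdiff_eq_empty.2 (image_mono inter_subset_left), measure_empty]
    · rintro _ ⟨⟨X, hX, rfl⟩, hX'⟩
      exact ⟨X, ⟨hX, fun hXS => hX' ⟨X, hXS, rfl⟩⟩, rfl⟩
  rw [← setIntegral_congr_set himg, ← setIntegral_congr_set hSU,
    integral_image_eq_integral_abs_det_fderiv_smul volume hSm (f' := fderiv ℝ f)
      (fun X hX => hX.2.hasFDerivAt.hasFDerivWithinAt) (h.injOn.mono inter_subset_left)]
  simp_rw [det_fderiv_eq, smul_eq_mul]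

end BiLip

end FSI

namespace FSI

open scoped ENNReal NNReal

/-! ### Weak gradients of compositions with bi-Lipschitz maps -/

lemma tendsto_integral_mul_of_tendsto_eLpNorm {α : Type*} {m : MeasurableSpace α} {μ : Measure α}
    {f g : ℕ → α → ℝ} {F G : α → ℝ} (hf : ∀ n, MemLp (f n) 2 μ) (hg : ∀ n, MemLp (g n) 2 μ)
    (hF : MemLp F 2 μ) (hG : MemLp G 2 μ)
    (hfF : Tendsto (fun n => eLpNorm (fun y => f n y - F y) 2 μ) atTop (𝓝 0))
    (hgG : Tendsto (fun n => eLpNorm (fun y => g n y - G y) 2 μ) atTop (𝓝 0)) :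
    Tendsto (fun n => ∫ y, f n y * g n y ∂μ) atTop (𝓝 (∫ y, F y * G y ∂μ)) := by
  have key : ∀ {a b : α → ℝ} (ha : MemLp a 2 μ) (hb : MemLp b 2 μ),
      inner ℝ (hb.toLp b) (ha.toLp a) = ∫ y, a y * b y ∂μ := by
    intro a b ha hb
    rw [L2.inner_def]
    refine integral_congr_ae ?_
    filter_upwards [ha.coeFn_toLp, hb.coeFn_toLp] with y h1 h2
    rw [h1, h2]; simp
  have h1 := (Lp.tendsto_Lp_iff_tendsto_eLpNorm'' f hf F hF).2 hfF
  have h2 := (Lp.tendsto_Lp_iff_tendsto_eLpNorm'' g hg G hG).2 hgG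
  have h3 := h2.inner (𝕜 := ℝ) h1
  simpa only [key] using h3

variable {d : ℕ}

lemma contDiff_apply_of_contDiff {n : WithTop ℕ∞} {φ : Vec d → Vec d} (h : ContDiff ℝ n φ)
    (i : Fin d) : ContDiff ℝ n fun y => φ y i :=
  (EuclideanSpace.proj (𝕜 := ℝ) i).contDiff.comp h

lemma continuous_fderiv_apply {φ : Vec d → ℝ} (h : ContDiff ℝ ∞ φ) (v : Vec d) :
    Continuous fun y => fderiv ℝ φ y v :=
  (h.continuous_fderiv (by simp)).clm_apply continuous_const

lemma continuous_jacobian_apply {φ : Vec d → Vec d} (h : ContDiff ℝ ∞ φ) (i j : Fin d) :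
    Continuous fun y => jacobian φ y i j :=
  (EuclideanSpace.proj (𝕜 := ℝ) i).continuous.comp
    ((h.continuous_fderiv (by simp)).clm_apply continuous_const)

lemma memLp_of_continuous_of_hasCompactSupport {φ : Vec d → ℝ} (h : Continuous φ)
    (hc : HasCompactSupport φ) (q : ℝ≥0∞) (μ : Measure (Vec d)) [IsFiniteMeasureOnCompacts μ] :
    MemLp φ q μ :=
  h.memLp_of_hasCompactSupport hc

lemma hasCompactSupport_fderiv_apply {φ : Vec d → ℝ} (hc : HasCompactSupport φ) (v : Vec d) :
    HasCompactSupport fun y => fderiv ℝ φ y v :=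
  hc.fderiv_apply ℝ v

lemma hasCompactSupport_apply {φ : Vec d → Vec d} (hc : HasCompactSupport φ) (i : Fin d) :
    HasCompactSupport fun y => φ y i :=
  hc.comp_left (g := fun w : Vec d => w i) (by simp)

lemma hasCompactSupport_jacobian_apply {φ : Vec d → Vec d} (hc : HasCompactSupport φ)
    (i j : Fin d) : HasCompactSupport fun y => jacobian φ y i j :=
  (hc.fderiv_apply ℝ (EuclideanSpace.single j 1)).comp_left (g := fun w : Vec d => w i) (by simp)

/-- The pointwise gradient of a Lipschitz map, which exists almost everywhere, is its weak
gradient. -/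
lemma hasWeakGradient_of_lipschitzOnWith {L : ℝ≥0} {U : Set (Vec d)} {f : Vec d → Vec d}
    (hU : IsOpen U) (hf : LipschitzOnWith L f U) : HasWeakGradient U f (jacobian f) := by
  intro φ hφ hφc hφU i j
  obtain ⟨g, hg, hfg⟩ := hf.extend_finite_dimension
  obtain ⟨C, hC⟩ := hφ.lipschitzWith_of_hasCompactSupport hφc (by simp)
  have hgi : LipschitzWith (‖EuclideanSpace.proj (𝕜 := ℝ) i‖₊ *
      (lipschitzExtensionConstant (Vec d) * L)) (fun y => g y i) :=
    (EuclideanSpace.proj i : Vec d →L[ℝ] ℝ).lipschitz.comp hg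
  have key := hgi.integral_lineDeriv_mul_eq (μ := volume) hC hφc (EuclideanSpace.single j 1)
  have hsupp : ∀ y, y ∉ U → φ y = 0 := fun y hy => image_eq_zero_of_notMem_tsupport
    fun h => hy (hφU h)
  have hsupp' : ∀ y, y ∉ U → fderiv ℝ φ y = 0 := fun y hy =>
    image_eq_zero_of_notMem_tsupport fun h => hy (hφU (tsupport_fderiv_subset ℝ h))
  have h1 : ∫ y in U, f y i * fderiv ℝ φ y (EuclideanSpace.single j 1)
      = - ∫ y, lineDeriv ℝ φ y (-EuclideanSpace.single j 1) * g y i := by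
    rw [← integral_neg]
    refine (setIntegral_congr_fun hU.measurableSet fun y hy => ?_).trans
      (setIntegral_eq_integral_of_forall_compl_eq_zero fun y hy => ?_)
    · simp only
      rw [((hφ.differentiable (by simp)) y).lineDeriv_eq_fderiv, map_neg, hfg hy]
      ring
    · rw [((hφ.differentiable (by simp)) y).lineDeriv_eq_fderiv, map_neg, hsupp' y hy]; simp
  have h2 : ∫ y in U, jacobian f y i j * φ y
      = ∫ y, lineDeriv ℝ (fun y => g y i) y (EuclideanSpace.single j 1) * φ y := by
    refine (setIntegral_congr_ae hU.measurableSet ?_).trans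
      (setIntegral_eq_integral_of_forall_compl_eq_zero fun y hy => ?_)
    · filter_upwards [hg.ae_differentiableAt (μ := volume)] with y hy hyU
      have hev : f =ᶠ[𝓝 y] g := Filter.eventuallyEq_of_mem (hU.mem_nhds hyU) hfg
      have h3 : HasFDerivAt (fun y => g y i)
          ((EuclideanSpace.proj (𝕜 := ℝ) i).comp (fderiv ℝ g y)) y :=
        (EuclideanSpace.proj (𝕜 := ℝ) i).hasFDerivAt.comp y hy.hasFDerivAt
      rw [h3.differentiableAt.lineDeriv_eq_fderiv, h3.fderiv, jacobian, Matrix.of_apply,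
        hev.fderiv_eq]
      rfl
    · rw [hsupp y hy, mul_zero]
  rw [h1, h2, key]

lemma HasWeakGradient.congr_ae {U : Set (Vec d)} {v : Vec d → Vec d} {G G' : Vec d → Tensor d}
    (h : HasWeakGradient U v G) (hG : G =ᵐ[volume.restrict U] G') : HasWeakGradient U v G' := by
  intro φ h1 h2 h3 i j
  rw [h φ h1 h2 h3 i j]
  congr 1
  refine integral_congr_ae ?_
  filter_upwards [hG] with y hy
  rw [hy]

lemma MemLp.coord {α : Type*} {m : MeasurableSpace α} {μ : Measure α} {q : ℝ≥0∞}
    {w : α → Vec d} (h : MemLp w q μ) (i : Fin d) : MemLp (fun y => w y i) q μ :=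
  (EuclideanSpace.proj i : Vec d →L[ℝ] ℝ).comp_memLp' h

lemma tendsto_eLpNorm_coord {α : Type*} {m : MeasurableSpace α} {μ : Measure α} {q : ℝ≥0∞}
    {w : ℕ → α → Vec d} {v : α → Vec d}
    (h : Tendsto (fun n => eLpNorm (fun y => w n y - v y) q μ) atTop (𝓝 0)) (i : Fin d) :
    Tendsto (fun n => eLpNorm (fun y => w n y i - v y i) q μ) atTop (𝓝 0) :=
  tendsto_of_tendsto_of_tendsto_of_le_of_le tendsto_const_nhds h (fun _ => zero_le) fun n =>
    eLpNorm_mono fun y => PiLp.norm_apply_le (w n y - v y) i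

lemma MemLp.mul_jacobian {L : ℝ≥0} {U : Set (Vec d)} {f : Vec d → Vec d} (hU : IsOpen U)
    (hf : LipschitzOnWith L f U) {g : Vec d → ℝ} (hg : MemLp g 2 (volume.restrict U))
    (i j : Fin d) : MemLp (fun X => g X * jacobian f X i j) 2 (volume.restrict U) := by
  refine MemLp.of_le_mul (c := L) hg
    (hg.1.mul (measurable_jacobian_apply f i j).aestronglyMeasurable) ?_
  rw [ae_restrict_iff' hU.measurableSet]
  refine ae_of_all _ fun X hX => ?_
  rw [norm_mul, mul_comm]
  exact mul_le_mul_of_nonneg_right (abs_jacobian_apply_le hU hf hX i j) (norm_nonneg _)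

lemma setIntegral_matrix_mul_apply {U : Set (Vec d)} {A F : Vec d → Tensor d} {ψ : Vec d → ℝ}
    {i j : Fin d} (hA : ∀ k, MemLp (fun X => A X i k) 2 (volume.restrict U))
    (hF : ∀ k, MemLp (fun X => ψ X * F X k j) 2 (volume.restrict U)) :
    ∫ X in U, (A X * F X) i j * ψ X = ∑ k, ∫ X in U, A X i k * (ψ X * F X k j) := by
  have hi : ∀ k, Integrable (fun X => A X i k * (ψ X * F X k j)) (volume.restrict U) := fun k =>
    (hA k).integrable_mul (hF k)
  rw [← integral_finsetSum _ fun k _ => hi k]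
  refine integral_congr_ae (ae_of_all _ fun X => ?_)
  simp only [Matrix.mul_apply, Finset.sum_mul]
  exact Finset.sum_congr rfl fun k _ => by ring

/-- The chain rule for the composition of a function in `H¹₀` with a bi-Lipschitz map: it holds for
the smooth approximants, whose compositions are Lipschitz, and passes to the limit. -/
lemma MemH10.comp_biLip {L K : ℝ≥0} {U Ω : Set (Vec d)} {f : Vec d → Vec d}
    (h : BiLip L K U Ω f) {v : Vec d → Vec d} {G : Vec d → Tensor d} (hv : MemH10 Ω v G) :
    MemH1 U (fun X => v (f X)) fun X => G (f X) * jacobian f X := by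
  obtain ⟨φ, hφ, hφv, hφG⟩ := hv.approx
  have hGf : ∀ i k, MemLp (fun X => G (f X) i k) 2 (volume.restrict U) := fun i k =>
    h.memLp_comp (hv.memLp_grad i k)
  have hJm : ∀ n i k, MemLp (fun y => jacobian (φ n) y i k) 2 (volume.restrict Ω) :=
    fun n i k => memLp_of_continuous_of_hasCompactSupport
      (continuous_jacobian_apply (hφ n).1 i k) (hasCompactSupport_jacobian_apply (hφ n).2.1 i k) _ _
  have hJf : ∀ n i k, MemLp (fun X => jacobian (φ n) (f X) i k) 2 (volume.restrict U) :=
    fun n i k => h.memLp_comp (hJm n i k)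
  have hφm : ∀ n, MemLp (φ n) 2 (volume.restrict Ω) := fun n =>
    (hφ n).1.continuous.memLp_of_hasCompactSupport (hφ n).2.1
  have hvf : MemLp (fun X => v (f X)) 2 (volume.restrict U) := h.memLp_comp hv.memLp
  have hφf : ∀ n, MemLp (fun X => φ n (f X)) 2 (volume.restrict U) := fun n =>
    h.memLp_comp (hφm n)
  have hφvf : Tendsto (fun n => eLpNorm (fun X => φ n (f X) - v (f X)) 2 (volume.restrict U))
      atTop (𝓝 0) :=
    h.tendsto_eLpNorm_comp (g := fun n y => φ n y - v y) (fun n => ((hφm n).sub hv.memLp).1) hφv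
  have hJGf : ∀ i k, Tendsto (fun n => eLpNorm (fun X => jacobian (φ n) (f X) i k - G (f X) i k) 2
      (volume.restrict U)) atTop (𝓝 0) := fun i k =>
    h.tendsto_eLpNorm_comp (g := fun n y => jacobian (φ n) y i k - G y i k)
      (fun n => ((hJm n i k).sub (hv.memLp_grad i k)).1) (hφG i k)
  refine ⟨hvf, fun i j => ?_, fun ψ hψ hψc hψU i j => ?_⟩
  · simp only [Matrix.mul_apply]
    exact memLp_finsetSum _ fun k _ => MemLp.mul_jacobian h.isOpen h.lipschitz (hGf i k) k j
  have hψ2 : MemLp ψ 2 (volume.restrict U) :=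
    memLp_of_continuous_of_hasCompactSupport hψ.continuous hψc _ _
  have hψ2' : ∀ k, MemLp (fun X => ψ X * jacobian f X k j) 2 (volume.restrict U) := fun k =>
    MemLp.mul_jacobian h.isOpen h.lipschitz hψ2 k j
  have hdψ : MemLp (fun X => fderiv ℝ ψ X (EuclideanSpace.single j 1)) 2 (volume.restrict U) :=
    memLp_of_continuous_of_hasCompactSupport (continuous_fderiv_apply hψ _)
      (hasCompactSupport_fderiv_apply hψc _) _ _
  have hzero : ∀ g : Vec d → ℝ,
      Tendsto (fun _ : ℕ => eLpNorm (fun y => g y - g y) 2 (volume.restrict U)) atTop (𝓝 0) := by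
    intro g; simp
  have happ : ∀ n, ∫ X in U, φ n (f X) i * fderiv ℝ ψ X (EuclideanSpace.single j 1)
      = - ∑ k, ∫ X in U, jacobian (φ n) (f X) i k * (ψ X * jacobian f X k j) := by
    intro n
    obtain ⟨C, hC⟩ := (hφ n).1.lipschitzWith_of_hasCompactSupport (hφ n).2.1 (by simp)
    have h1 := hasWeakGradient_of_lipschitzOnWith h.isOpen (hC.comp_lipschitzOnWith h.lipschitz)
    have h2 : jacobian (φ n ∘ f) =ᵐ[volume.restrict U]
        fun X => jacobian (φ n) (f X) * jacobian f X := by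
      filter_upwards [h.ae_differentiableAt] with X hX
      exact jacobian_comp ((hφ n).1.differentiable (by simp) _) hX
    have h3 := h1.congr_ae h2 ψ hψ hψc hψU i j
    simp only [Function.comp_apply] at h3
    rw [h3, setIntegral_matrix_mul_apply (fun k => hJf n i k) hψ2']
  have hl : Tendsto (fun n => ∫ X in U, φ n (f X) i * fderiv ℝ ψ X (EuclideanSpace.single j 1))
      atTop (𝓝 (∫ X in U, v (f X) i * fderiv ℝ ψ X (EuclideanSpace.single j 1))) :=
    tendsto_integral_mul_of_tendsto_eLpNorm
      (fun n => MemLp.coord (hφf n) i) (fun _ => hdψ) (MemLp.coord hvf i) hdψ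
      (tendsto_eLpNorm_coord hφvf i) (hzero _)
  have hr : Tendsto (fun n => - ∑ k, ∫ X in U, jacobian (φ n) (f X) i k * (ψ X * jacobian f X k j))
      atTop (𝓝 (- ∑ k, ∫ X in U, G (f X) i k * (ψ X * jacobian f X k j))) := by
    refine (tendsto_finsetSum _ fun k _ => ?_).neg
    exact tendsto_integral_mul_of_tendsto_eLpNorm (fun n => hJf n i k)
      (fun _ => hψ2' k) (hGf i k) (hψ2' k)
      (hJGf i k) (hzero _)
  simp only [happ] at hl
  rw [tendsto_nhds_unique hl hr, setIntegral_matrix_mul_apply (hGf i) hψ2']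

end FSI

namespace FSI

open scoped ENNReal NNReal

/-! ### Primitives in time and their chain rule -/

lemma AbsolutelyContinuousOnInterval.of_dist_le {f g : ℝ → ℝ} {a b K : ℝ}
    (hg : AbsolutelyContinuousOnInterval g a b)
    (h : ∀ r ∈ uIcc a b, ∀ s ∈ uIcc a b, dist (f r) (f s) ≤ K * dist (g r) (g s)) :
    AbsolutelyContinuousOnInterval f a b := by
  unfold AbsolutelyContinuousOnInterval at hg ⊢
  refine squeeze_zero'
    (Filter.Eventually.of_forall fun _ => Finset.sum_nonneg fun _ _ => dist_nonneg) ?_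
    (by simpa using hg.const_mul K)
  rw [eventually_inf_principal]
  filter_upwards with E hE
  rw [Finset.mul_sum]
  exact Finset.sum_le_sum fun i hi => h _ (hE.1 i hi).1 _ (hE.1 i hi).2

/-- The chain rule for a `C¹` function of an absolutely continuous curve, given as a primitive. -/
lemma sub_eq_integral_fderiv_primitive {E : Type*} [NormedAddCommGroup E] [NormedSpace ℝ E]
    [FiniteDimensional ℝ E] {Φ : E → ℝ} (hΦ : ContDiff ℝ 1 Φ) {f : ℝ → E} {t : ℝ}
    (hf : IntervalIntegrable f volume 0 t) (c : E) :
    Φ (c + ∫ s in 0..t, f s) - Φ c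
      = ∫ s in 0..t, fderiv ℝ Φ (c + ∫ r in 0..s, f r) (f s) := by
  have hproper : ProperSpace E := FiniteDimensional.proper ℝ E
  set F : ℝ → E := fun s => c + ∫ r in 0..s, f r with hF
  have hcont : ContinuousOn F (uIcc 0 t) := by
    refine continuousOn_const.add ?_
    exact intervalIntegral.continuousOn_primitive_interval' hf left_mem_uIcc
  -- The curve stays in a ball, on which `Φ` is Lipschitz; so `Φ ∘ F` is absolutely continuous.
  obtain ⟨R, hR⟩ := (isCompact_uIcc.image_of_continuousOn hcont).isBounded.subset_closedBall 0
  obtain ⟨K, hK⟩ := hΦ.contDiffOn.exists_lipschitzOnWith (by simp)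
    (convex_closedBall (0 : E) R) (isCompact_closedBall 0 R)
  have hN := hf.norm.absolutelyContinuousOnInterval_intervalIntegral (c := 0) left_mem_uIcc
  have hsub : ∀ r ∈ uIcc 0 t, ∀ s ∈ uIcc 0 t, IntervalIntegrable f volume r s := fun r hr s hs =>
    hf.mono_set (uIcc_subset_uIcc hr hs)
  have hac : AbsolutelyContinuousOnInterval (fun s => Φ (F s)) 0 t := by
    refine AbsolutelyContinuousOnInterval.of_dist_le (K := K) hN fun r hr s hs => ?_
    refine (hK.dist_le_mul _ (hR (mem_image_of_mem F hr)) _ (hR (mem_image_of_mem F hs))).trans ?_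
    refine mul_le_mul_of_nonneg_left ?_ K.2
    have h1 := hsub 0 left_mem_uIcc r hr
    have h2 := hsub 0 left_mem_uIcc s hs
    rw [dist_eq_norm, dist_eq_norm, hF]
    simp only [add_sub_add_left_eq_sub]
    rw [intervalIntegral.integral_interval_sub_left h1 h2,
      intervalIntegral.integral_interval_sub_left h1.norm h2.norm, Real.norm_eq_abs]
    exact intervalIntegral.norm_integral_le_abs_integral_norm
  have hder : ∀ᵐ s, s ∈ uIoc 0 t → deriv (fun s => Φ (F s)) s = fderiv ℝ Φ (F s) (f s) := by
    filter_upwards [hf.ae_hasDerivAt_integral] with s hs hst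
    have h1 : HasDerivAt F (f s) s := by
      simpa [hF] using (hs (uIoc_subset_uIcc hst) 0 left_mem_uIcc).const_add c
    exact ((hΦ.differentiable (by simp) (F s)).hasFDerivAt.comp_hasDerivAt s h1).deriv
  have hF0 : F 0 = c := by simp [hF]
  have h3 := hac.integral_deriv_eq_sub
  rw [intervalIntegral.integral_congr_ae hder] at h3
  rw [h3, hF0]

variable {S : Type*} {mS : MeasurableSpace S} {ν : Measure S} [IsFiniteMeasure ν]
  {E : Type*} [NormedAddCommGroup E] {T : ℝ}

/-- The curve with initial value `w₀ X` and velocity `wt · X`. It is the representative of a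
function in `H¹(0, T; L²)` that is absolutely continuous in time. -/
noncomputable def primitive [NormedSpace ℝ E] (w₀ : S → E) (wt : ℝ → S → E) (t : ℝ) (X : S) : E :=
  w₀ X + ∫ s in 0..t, wt s X

/-- Almost everywhere equality on a product can be tested on almost every section, provided both
functions are measurable. -/
lemma ae_eq_prod_of_ae_ae {α β F : Type*} {mα : MeasurableSpace α} {mβ : MeasurableSpace β}
    {μ : Measure α} {ρ : Measure β} [SFinite ρ] [NormedAddCommGroup F] {f g : α × β → F}
    (hf : AEStronglyMeasurable f (μ.prod ρ)) (hg : AEStronglyMeasurable g (μ.prod ρ))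
    (h : ∀ᵐ s ∂μ, ∀ᵐ X ∂ρ, f (s, X) = g (s, X)) : f =ᵐ[μ.prod ρ] g := by
  have h1 := hf.ae_eq_mk
  have h2 := hg.ae_eq_mk
  have h3 : hf.mk f =ᵐ[μ.prod ρ] hg.mk g := by
    refine (Measure.ae_prod_iff_ae_ae
      (hf.stronglyMeasurable_mk.measurableSet_eq_fun hg.stronglyMeasurable_mk)).2 ?_
    filter_upwards [Measure.ae_ae_of_ae_prod h1, Measure.ae_ae_of_ae_prod h2, h] with s a1 a2 a3
    filter_upwards [a1, a2, a3] with X b1 b2 b3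
    rw [← b1, ← b2, b3]
  exact h1.trans (h3.trans h2.symm)

lemma ae_ae_swap {α β : Type*} {mα : MeasurableSpace α} {mβ : MeasurableSpace β}
    {μ : Measure α} {ρ : Measure β} [SFinite μ] [SFinite ρ] {P : α × β → Prop}
    (h : ∀ᵐ z ∂(μ.prod ρ), P z) : ∀ᵐ X ∂ρ, ∀ᵐ s ∂μ, P (s, X) := by
  have := (Measure.measurePreserving_swap (μ := ρ) (ν := μ)).quasiMeasurePreserving.ae h
  exact Measure.ae_ae_of_ae_prod this

lemma intervalIntegral_eq_setIntegral_ite [NormedSpace ℝ E] {t : ℝ} (ht : t ∈ Icc 0 T) (f : ℝ → E) :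
    ∫ s in 0..t, f s = ∫ s in Icc 0 T, if s ≤ t then f s else 0 := by
  rw [intervalIntegral.integral_of_le ht.1, ← integral_Icc_eq_integral_Ioc]
  have : (fun s => if s ≤ t then f s else 0) = indicator (Iic t) f := by
    ext s; simp [indicator_apply]
  rw [this, setIntegral_indicator measurableSet_Iic]
  congr 2
  ext s
  simp only [mem_Icc, mem_inter_iff, mem_Iic]
  exact ⟨fun h => ⟨⟨h.1, h.2.trans ht.2⟩, h.2⟩, fun h => ⟨h.1.1, h.2⟩⟩

lemma aestronglyMeasurable_primitive [NormedSpace ℝ E] {w₀ : S → E} {wt : ℝ → S → E}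
    (h0 : AEStronglyMeasurable w₀ ν)
    (hw : AEStronglyMeasurable (fun z : ℝ × S => wt z.1 z.2)
      ((volume.restrict (Icc 0 T)).prod ν)) :
    AEStronglyMeasurable (fun z : ℝ × S => primitive w₀ wt z.1 z.2)
      ((volume.restrict (Icc 0 T)).prod ν) := by
  have h0' : AEStronglyMeasurable (fun z : ℝ × S => w₀ z.2)
      ((volume.restrict (Icc 0 T)).prod ν) := h0.comp_snd
  refine h0'.add ?_
  set g := hw.mk _ with hg
  have hgm : StronglyMeasurable g := hw.stronglyMeasurable_mk
  have hint : StronglyMeasurable fun z : ℝ × S =>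
      ∫ s in Icc 0 T, if s ≤ z.1 then g (s, z.2) else 0 := by
    have : StronglyMeasurable fun q : (ℝ × S) × ℝ =>
        if q.2 ≤ q.1.1 then g (q.2, q.1.2) else 0 := by
      refine StronglyMeasurable.ite
        (measurableSet_le measurable_snd (measurable_fst.comp measurable_fst)) ?_
        stronglyMeasurable_const
      exact hgm.comp_measurable (measurable_snd.prodMk (measurable_snd.comp measurable_fst))
    exact this.integral_prod_right'
  refine ⟨_, hint, ?_⟩
  have h1 : ∀ᵐ X ∂ν, ∀ᵐ s ∂(volume.restrict (Icc 0 T)), wt s X = g (s, X) :=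
    ae_ae_swap hw.ae_eq_mk
  have h2 : ∀ᵐ z ∂((volume.restrict (Icc (0 : ℝ) T)).prod ν), z.1 ∈ Icc 0 T :=
    Measure.quasiMeasurePreserving_fst.ae (ae_restrict_mem measurableSet_Icc)
  filter_upwards [Measure.quasiMeasurePreserving_snd.ae h1, h2] with z hz hz1
  rw [intervalIntegral_eq_setIntegral_ite hz1]
  refine integral_congr_ae ?_
  filter_upwards [hz] with s hs
  rw [hs]

lemma ae_intervalIntegrable {wt : ℝ → S → E}
    (hw : Integrable (fun z : ℝ × S => wt z.1 z.2) ((volume.restrict (Icc 0 T)).prod ν)) :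
    ∀ᵐ X ∂ν, ∀ t ∈ Icc 0 T, IntervalIntegrable (fun s => wt s X) volume 0 t := by
  filter_upwards [hw.prod_left_ae] with X hX t ht
  rw [intervalIntegrable_iff_integrableOn_Icc_of_le ht.1]
  exact IntegrableOn.mono_set hX (Icc_subset_Icc_right ht.2)

lemma ae_intervalIntegrable_integral [NormedSpace ℝ E] {k : ℝ → S → E}
    (hk : Integrable (fun z : ℝ × S => k z.1 z.2) ((volume.restrict (Icc 0 T)).prod ν))
    {t : ℝ} (ht : t ∈ Icc 0 T) :
    IntervalIntegrable (fun s => ∫ X, k s X ∂ν) volume 0 t := by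
  rw [intervalIntegrable_iff_integrableOn_Icc_of_le ht.1]
  exact IntegrableOn.mono_set hk.integral_prod_left (Icc_subset_Icc_right ht.2)

lemma integral_intervalIntegral_swap [NormedSpace ℝ E] {k : ℝ → S → E}
    (hk : Integrable (fun z : ℝ × S => k z.1 z.2) ((volume.restrict (Icc 0 T)).prod ν))
    {t : ℝ} (ht : t ∈ Icc 0 T) :
    ∫ X, (∫ s in 0..t, k s X) ∂ν = ∫ s in 0..t, ∫ X, k s X ∂ν := by
  simp only [intervalIntegral.integral_of_le ht.1]
  refine integral_integral_swap (f := fun X s => k s X) ?_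
  have h1 : Integrable (fun z : ℝ × S => k z.1 z.2) ((volume.restrict (Ioc 0 t)).prod ν) := by
    refine hk.mono_measure (Measure.prod_mono ?_ le_rfl)
    exact Measure.restrict_mono (Ioc_subset_Icc_self.trans (Icc_subset_Icc_right ht.2)) le_rfl
  exact h1.swap

/-- Integrated form of the chain rule `d/dt Φ(w) = DΦ(w) ∂ₜw`, with a time-independent weight. -/
lemma integral_sub_eq_integral_fderiv [NormedSpace ℝ E] [FiniteDimensional ℝ E]
    {Φ : E → ℝ} (hΦ : ContDiff ℝ 1 Φ) {m : S → ℝ}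
    {w wt : ℝ → S → E}
    (hw : Integrable (fun z : ℝ × S => wt z.1 z.2) ((volume.restrict (Icc 0 T)).prod ν))
    (hprim : ∀ t ∈ Icc 0 T, w t =ᵐ[ν] primitive (w 0) wt t)
    (hk : Integrable (fun z : ℝ × S =>
      m z.2 * fderiv ℝ Φ (primitive (w 0) wt z.1 z.2) (wt z.1 z.2))
      ((volume.restrict (Icc 0 T)).prod ν))
    (hint : ∀ t ∈ Icc 0 T, Integrable (fun X => m X * Φ (w t X)) ν) {t : ℝ} (ht : t ∈ Icc 0 T) :
    IntervalIntegrable (fun s => ∫ X, m X * fderiv ℝ Φ (w s X) (wt s X) ∂ν) volume 0 t ∧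
    (∫ X, m X * Φ (w t X) ∂ν) - ∫ X, m X * Φ (w 0 X) ∂ν
      = ∫ s in 0..t, ∫ X, m X * fderiv ℝ Φ (w s X) (wt s X) ∂ν := by
  have hcongr : ∀ s ∈ uIoc 0 t, ∫ X, m X * fderiv ℝ Φ (primitive (w 0) wt s X) (wt s X) ∂ν
      = ∫ X, m X * fderiv ℝ Φ (w s X) (wt s X) ∂ν := by
    intro s hs
    rw [uIoc_of_le ht.1] at hs
    refine integral_congr_ae ?_
    filter_upwards [hprim s ⟨hs.1.le, hs.2.trans ht.2⟩] with X hX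
    rw [hX]
  refine ⟨(ae_intervalIntegrable_integral
    (k := fun s X => m X * fderiv ℝ Φ (primitive (w 0) wt s X) (wt s X)) hk ht).congr
      (fun s hs => hcongr s hs), ?_⟩
  rw [← intervalIntegral.integral_congr_ae (ae_of_all _ hcongr), ← integral_intervalIntegral_swap
    (k := fun s X => m X * fderiv ℝ Φ (primitive (w 0) wt s X) (wt s X)) hk ht,
    ← integral_sub (hint t ht) (hint 0 (left_mem_Icc.2 (ht.1.trans ht.2)))]
  refine integral_congr_ae ?_
  filter_upwards [hprim t ht, ae_intervalIntegrable hw] with X hX hXi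
  rw [intervalIntegral.integral_const_mul, hX, ← mul_sub]
  congr 1
  exact sub_eq_integral_fderiv_primitive hΦ (hXi t ht) (w 0 X)

lemma memLp_comp_snd {f : S → ℝ} (hf : MemLp f 2 ν) :
    MemLp (fun z : ℝ × S => f z.2) 2 ((volume.restrict (Icc 0 T)).prod ν) :=
  hf.comp_snd _

lemma sq_integral_le {f : ℝ → ℝ} (hT : 0 < T) (hf : MemLp f 2 (volume.restrict (Icc 0 T))) :
    (∫ s in Icc 0 T, f s) ^ 2 ≤ T * ∫ s in Icc 0 T, f s ^ 2 := by
  have hfi : Integrable f (volume.restrict (Icc 0 T)) := hf.integrable (by norm_num)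
  have hf2 : Integrable (fun s => f s ^ 2) (volume.restrict (Icc 0 T)) := hf.integrable_sq
  -- Expand the square of the deviation of `f` from its mean `A / T`.
  set A := ∫ s in Icc 0 T, f s
  have h0 : 0 ≤ ∫ s in Icc 0 T, (f s - A / T) ^ 2 := integral_nonneg fun s => sq_nonneg _
  have h1 : ∫ s in Icc 0 T, (f s - A / T) ^ 2
      = (∫ s in Icc 0 T, f s ^ 2) - 2 * (A / T) * A + T * (A / T) ^ 2 := by
    have e : ∀ s, (f s - A / T) ^ 2 = (f s ^ 2 - 2 * (A / T) * f s) + (A / T) ^ 2 :=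
      fun s => by ring
    simp_rw [e]
    have e1 : Integrable (fun s => f s ^ 2 - 2 * (A / T) * f s) (volume.restrict (Icc 0 T)) :=
      hf2.sub (hfi.const_mul _)
    rw [integral_add e1 (integrable_const _),
      integral_sub hf2 (hfi.const_mul _), integral_const_mul, integral_const]
    change _ - 2 * (A / T) * A + _ = _
    simp [hT.le]
  rw [h1] at h0
  have h2 : T * ((∫ s in Icc 0 T, f s ^ 2) - 2 * (A / T) * A + T * (A / T) ^ 2)
      = T * (∫ s in Icc 0 T, f s ^ 2) - A ^ 2 := by field_simp; ring
  have h3 := mul_nonneg hT.le h0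
  rw [h2] at h3
  linarith

/-- `∫₀ᵀ ‖wt‖` is square integrable in space, by the Cauchy-Schwarz inequality in time. -/
lemma memLp_integral_norm (hT : 0 < T) {wt : ℝ → S → E}
    (hw : MemLp (fun z : ℝ × S => wt z.1 z.2) 2 ((volume.restrict (Icc 0 T)).prod ν)) :
    MemLp (fun X => ∫ s in Icc 0 T, ‖wt s X‖) 2 ν := by
  have hm : AEStronglyMeasurable (fun X => ∫ s in Icc 0 T, ‖wt s X‖) ν := by
    have := hw.1.norm.prod_swap.integral_prod_right'
    simpa using this
  have h2 : Integrable (fun z : ℝ × S => ‖wt z.1 z.2‖ ^ 2)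
      ((volume.restrict (Icc 0 T)).prod ν) := hw.norm.integrable_sq
  refine (memLp_two_iff_integrable_sq hm).2 ?_
  refine (h2.integral_prod_right.const_mul T).mono' (hm.pow 2) ?_
  have hm' : ∀ᵐ X ∂ν, AEStronglyMeasurable (fun s => ‖wt s X‖) (volume.restrict (Icc 0 T)) :=
    hw.1.norm.prod_swap.prodMk_left
  filter_upwards [hm', h2.prod_left_ae] with X h3 h4
  rw [Real.norm_eq_abs, abs_of_nonneg (sq_nonneg _)]
  exact sq_integral_le hT ((memLp_two_iff_integrable_sq h3).2 h4)

lemma memLp_primitive [NormedSpace ℝ E] (hT : 0 < T) {w₀ : S → E} {wt : ℝ → S → E}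
    (h0 : MemLp w₀ 2 ν)
    (hw : MemLp (fun z : ℝ × S => wt z.1 z.2) 2 ((volume.restrict (Icc 0 T)).prod ν)) :
    MemLp (fun z : ℝ × S => primitive w₀ wt z.1 z.2) 2
      ((volume.restrict (Icc 0 T)).prod ν) := by
  have hM : MemLp (fun X => ‖w₀ X‖ + ∫ s in Icc 0 T, ‖wt s X‖) 2 ν :=
    h0.norm.add (memLp_integral_norm hT hw)
  have hwi : Integrable (fun z : ℝ × S => wt z.1 z.2) ((volume.restrict (Icc 0 T)).prod ν) :=
    hw.integrable (by norm_num)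
  refine MemLp.of_le (memLp_comp_snd hM) (aestronglyMeasurable_primitive h0.1 hw.1) ?_
  have h2 : ∀ᵐ z ∂((volume.restrict (Icc (0 : ℝ) T)).prod ν), z.1 ∈ Icc 0 T :=
    Measure.quasiMeasurePreserving_fst.ae (ae_restrict_mem measurableSet_Icc)
  filter_upwards [h2, Measure.quasiMeasurePreserving_snd.ae hwi.prod_left_ae] with z hz hz2
  refine le_trans ?_ (le_abs_self _)
  refine (norm_add_le _ _).trans (add_le_add le_rfl ?_)
  rw [intervalIntegral.integral_of_le hz.1]
  refine (norm_integral_le_integral_norm _).trans ?_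
  exact setIntegral_mono_set hz2.norm (ae_of_all _ fun _ => norm_nonneg _)
    (Ioc_subset_Icc_self.trans (Icc_subset_Icc_right hz.2)).eventuallyLE

end FSI

namespace FSI

open scoped ENNReal NNReal

/-! ### The convective term -/

variable {d : ℕ}

lemma norm_le_sum_norm_apply_single (A : Vec d →L[ℝ] ℝ) :
    ‖A‖ ≤ ∑ j, ‖A (EuclideanSpace.single j 1)‖ := by
  refine A.opNorm_le_bound (Finset.sum_nonneg fun _ _ => norm_nonneg _) fun w => ?_
  conv_lhs => rw [eq_sum_smul_single w, map_sum]
  rw [Finset.sum_mul]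
  refine (norm_sum_le _ _).trans (Finset.sum_le_sum fun j _ => ?_)
  rw [map_smul, norm_smul, mul_comm]
  exact mul_le_mul_of_nonneg_left (PiLp.norm_apply_le w j) (norm_nonneg _)

/-- An exponent `p ≤ 2` of the gradient for which the subcritical Sobolev inequality bounds the `L⁴`
norm. -/
lemma exists_sobolev_exponent (hd : d = 2 ∨ d = 3) : ∃ p : ℝ≥0, 1 ≤ p ∧ p ≤ 2 ∧ p < (d : ℝ≥0) ∧
    ((p : ℝ)⁻¹ - (d : ℝ)⁻¹ ≤ ((4 : ℝ≥0) : ℝ)⁻¹) := by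
  rcases hd with rfl | rfl
  · refine ⟨4 / 3, ?_, ?_, ?_, ?_⟩
    · rw [← NNReal.coe_le_coe]; push_cast; norm_num
    · rw [← NNReal.coe_le_coe]; push_cast; norm_num
    · rw [← NNReal.coe_lt_coe]; push_cast; norm_num
    · push_cast; norm_num
  · refine ⟨2, by norm_num, le_rfl, by norm_num, ?_⟩
    push_cast; norm_num

lemma exists_eLpNorm_le_eLpNorm_fderiv {Ω : Set (Vec d)} (hΩ : Bornology.IsBounded Ω) (p q : ℝ≥0)
    (hp1 : 1 ≤ p) (hpd : p < (d : ℝ≥0)) (hpq : (p : ℝ)⁻¹ - (d : ℝ)⁻¹ ≤ (q : ℝ)⁻¹) :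
    ∃ C : ℝ≥0, ∀ ψ : Vec d → ℝ, ContDiff ℝ 1 ψ → Function.support ψ ⊆ Ω →
      eLpNorm ψ (q : ℝ≥0∞) volume ≤ C * eLpNorm (fderiv ℝ ψ) p volume := by
  have hdim : Module.finrank ℝ (Vec d) = d := by simp
  exact ⟨_, fun ψ h1 h2 => eLpNorm_le_eLpNorm_fderiv_of_le (volume : Measure (Vec d)) h1 h2 hp1
    (by rwa [hdim]) (by rwa [hdim]) hΩ⟩

lemma exists_eLpNorm_le_eLpNorm_two {α F : Type*} {mα : MeasurableSpace α} [NormedAddCommGroup F]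
    (μ : Measure α) [IsFiniteMeasure μ] {p : ℝ≥0} (hp1 : 1 ≤ p) (hp2 : p ≤ 2) :
    ∃ c : ℝ≥0∞, c ≠ ⊤ ∧ ∀ f : α → F, AEStronglyMeasurable f μ →
      eLpNorm f p μ ≤ c * eLpNorm f 2 μ := by
  refine ⟨μ univ ^ (1 / (p : ℝ≥0∞).toReal - 1 / (2 : ℝ≥0∞).toReal),
    (ENNReal.rpow_lt_top_of_nonneg ?_ (measure_ne_top μ univ)).ne, fun f hf => ?_⟩
  · have hp0 : (0 : ℝ) < p := lt_of_lt_of_le one_pos (by exact_mod_cast hp1)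
    have hp2' : (p : ℝ) ≤ 2 := by exact_mod_cast hp2
    simp only [ENNReal.coe_toReal, ENNReal.toReal_ofNat, sub_nonneg]
    exact one_div_le_one_div_of_le hp0 hp2'
  · rw [mul_comm]
    exact eLpNorm_le_eLpNorm_mul_rpow_measure_univ (by exact_mod_cast hp2) hf

lemma eLpNorm_fderiv_le_sum {ψ : Vec d → ℝ} (hψ : ContDiff ℝ ∞ ψ) (μ : Measure (Vec d)) :
    eLpNorm (fderiv ℝ ψ) 2 μ
      ≤ ∑ j, eLpNorm (fun y => fderiv ℝ ψ y (EuclideanSpace.single j 1)) 2 μ := by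
  have h5 : eLpNorm (fderiv ℝ ψ) 2 μ
      ≤ eLpNorm (∑ j, fun y => ‖fderiv ℝ ψ y (EuclideanSpace.single j 1)‖) 2 μ := by
    refine eLpNorm_mono fun y => ?_
    rw [Finset.sum_apply, Real.norm_of_nonneg (Finset.sum_nonneg fun _ _ => norm_nonneg _)]
    exact norm_le_sum_norm_apply_single _
  refine h5.trans ((eLpNorm_sum_le (fun j _ => ?_) (by norm_num)).trans
    (Finset.sum_le_sum fun j _ => (eLpNorm_norm _).le))
  exact (continuous_fderiv_apply hψ _).norm.aestronglyMeasurable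

/-- The Gagliardo-Nirenberg-Sobolev inequality `‖ψ‖_{L⁴} ≤ C ‖∇ψ‖_{L²}` in dimension two or three.
In dimension two, where `L²` is the critical exponent of the gradient, it is deduced from the
inequality with the `L^{4/3}` norm of the gradient. -/
lemma exists_eLpNorm_four_le (hd : d = 2 ∨ d = 3) {Ω : Set (Vec d)}
    (hΩ : Bornology.IsBounded Ω) :
    ∃ C : ℝ≥0∞, C ≠ ⊤ ∧ ∀ ψ : Vec d → ℝ, ContDiff ℝ ∞ ψ → tsupport ψ ⊆ Ω →
      eLpNorm ψ 4 (volume.restrict Ω)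
        ≤ C * ∑ j, eLpNorm (fun y => fderiv ℝ ψ y (EuclideanSpace.single j 1)) 2
            (volume.restrict Ω) := by
  obtain ⟨p, hp1, hp2, hpd, hpq⟩ := exists_sobolev_exponent hd
  have hfin : IsFiniteMeasure (volume.restrict Ω) := ⟨by simpa using hΩ.measure_lt_top⟩
  obtain ⟨C₀, hC₀⟩ := exists_eLpNorm_le_eLpNorm_fderiv hΩ p 4 hp1 hpd hpq
  rw [ENNReal.coe_ofNat] at hC₀
  obtain ⟨c₁, hc₁, hle⟩ := exists_eLpNorm_le_eLpNorm_two (F := Vec d →L[ℝ] ℝ)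
    (volume.restrict Ω) hp1 hp2
  refine ⟨C₀ * c₁, ENNReal.mul_ne_top (by simp) hc₁, fun ψ hψ hψΩ => ?_⟩
  have hcont : Continuous (fderiv ℝ ψ) := hψ.continuous_fderiv (by simp)
  have h1 := hC₀ ψ (hψ.of_le (by simp)) ((subset_tsupport ψ).trans hψΩ)
  have hsub : Function.support (fderiv ℝ ψ) ⊆ Ω :=
    (subset_tsupport _).trans ((tsupport_fderiv_subset ℝ).trans hψΩ)
  have h2 : eLpNorm (fderiv ℝ ψ) p (volume.restrict Ω) = eLpNorm (fderiv ℝ ψ) p volume :=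
    MeasureTheory.eLpNorm_restrict_eq_of_support_subset (f := fderiv ℝ ψ) hsub
  rw [← h2] at h1
  calc eLpNorm ψ 4 (volume.restrict Ω) ≤ eLpNorm ψ 4 volume :=
        eLpNorm_mono_measure _ Measure.restrict_le_self
    _ ≤ C₀ * (c₁ * eLpNorm (fderiv ℝ ψ) 2 (volume.restrict Ω)) :=
        h1.trans (mul_le_mul_right (hle _ hcont.aestronglyMeasurable) _)
    _ = C₀ * c₁ * eLpNorm (fderiv ℝ ψ) 2 (volume.restrict Ω) := (mul_assoc _ _ _).symm
    _ ≤ _ := mul_le_mul_right (eLpNorm_fderiv_le_sum hψ _) _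

lemma fderiv_apply_coord {φ : Vec d → Vec d} {y : Vec d} (h : DifferentiableAt ℝ φ y)
    (i j : Fin d) :
    fderiv ℝ (fun z => φ z i) y (EuclideanSpace.single j 1) = jacobian φ y i j := by
  have h3 : HasFDerivAt (fun y => φ y i)
      ((EuclideanSpace.proj (𝕜 := ℝ) i).comp (fderiv ℝ φ y)) y :=
    (EuclideanSpace.proj (𝕜 := ℝ) i).hasFDerivAt.comp y h.hasFDerivAt
  rw [h3.fderiv]
  rfl

lemma tsupport_apply_subset (φ : Vec d → Vec d) (i : Fin d) :
    tsupport (fun y => φ y i) ⊆ tsupport φ := by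
  refine closure_mono fun y hy => ?_
  rw [Function.mem_support] at hy ⊢
  exact fun h0 => hy (by simp [h0])

/-- The smooth approximants of a function in `H¹₀` also converge in `L⁴`. -/
lemma MemH10.tendsto_eLpNorm_four (hd : d = 2 ∨ d = 3) {Ω : Set (Vec d)}
    (hΩ : Bornology.IsBounded Ω) {v : Vec d → Vec d} {G : Vec d → Tensor d} (hv : MemH1 Ω v G)
    {φ : ℕ → Vec d → Vec d}
    (hφ : ∀ n, ContDiff ℝ ∞ (φ n) ∧ HasCompactSupport (φ n) ∧ tsupport (φ n) ⊆ Ω)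
    (hφv : Tendsto (fun n => eLpNorm (fun y => φ n y - v y) 2 (volume.restrict Ω)) atTop (𝓝 0))
    (hφG : ∀ i j, Tendsto (fun n => eLpNorm (fun y => jacobian (φ n) y i j - G y i j) 2
      (volume.restrict Ω)) atTop (𝓝 0)) (i : Fin d) :
    MemLp (fun y => v y i) 4 (volume.restrict Ω) ∧
    Tendsto (fun n => eLpNorm (fun y => φ n y i - v y i) 4 (volume.restrict Ω)) atTop (𝓝 0) := by
  obtain ⟨C, hC, hGNS⟩ := exists_eLpNorm_four_le hd hΩ
  set μ := volume.restrict Ω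
  set e : ℕ → ℝ≥0∞ := fun n => ∑ j, eLpNorm (fun y => jacobian (φ n) y i j - G y i j) 2 μ with he
  have he0 : Tendsto e atTop (𝓝 0) := by
    have := tendsto_finsetSum Finset.univ fun j (_ : j ∈ Finset.univ) => hφG i j
    simpa using this
  have hJm : ∀ n j, MemLp (fun y => jacobian (φ n) y i j) 2 μ := fun n j =>
    memLp_of_continuous_of_hasCompactSupport (continuous_jacobian_apply (hφ n).1 i j)
      (hasCompactSupport_jacobian_apply (hφ n).2.1 i j) _ _
  have hφc : ∀ n, Continuous fun y => φ n y i := fun n =>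
    (contDiff_apply_of_contDiff (hφ n).1 i).continuous
  have hφ4 : ∀ n, MemLp (fun y => φ n y i) 4 μ := fun n =>
    memLp_of_continuous_of_hasCompactSupport (hφc n) (hasCompactSupport_apply (hφ n).2.1 i) _ _
  have hvm : AEStronglyMeasurable (fun y => v y i) μ := (MemLp.coord hv.memLp i).1
  have hdiff : ∀ n m, eLpNorm (fun y => φ n y i - φ m y i) 4 μ ≤ C * (e n + e m) := by
    intro n m
    have hs : ContDiff ℝ ∞ fun y => φ n y - φ m y := (hφ n).1.sub (hφ m).1
    have hsupp : tsupport (fun y => φ n y i - φ m y i) ⊆ Ω := by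
      refine (tsupport_sub _ _).trans (union_subset ?_ ?_)
      · exact (tsupport_apply_subset _ i).trans (hφ n).2.2
      · exact (tsupport_apply_subset _ i).trans (hφ m).2.2
    refine (hGNS _ (contDiff_apply_of_contDiff hs i) hsupp).trans ?_
    gcongr
    rw [he, ← Finset.sum_add_distrib]
    refine Finset.sum_le_sum fun j _ => ?_
    have hfd : (fun y => fderiv ℝ (fun y => (φ n y - φ m y) i) y (EuclideanSpace.single j 1))
        = (fun y => jacobian (φ n) y i j - G y i j) - fun y => jacobian (φ m) y i j - G y i j := by
      ext y
      have d1 := (hφ n).1.differentiable (by simp) y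
      have d2 := (hφ m).1.differentiable (by simp) y
      rw [fderiv_apply_coord (d1.fun_sub d2)]
      simp only [jacobian, Matrix.of_apply, fderiv_fun_sub d1 d2, Pi.sub_apply]
      simp
    rw [hfd]
    exact eLpNorm_sub_le ((hJm n j).sub (hv.memLp_grad i j)).1
      ((hJm m j).sub (hv.memLp_grad i j)).1 (by norm_num)
  obtain ⟨ns, hns, hlim⟩ := (tendstoInMeasure_of_tendsto_eLpNorm (μ := μ) (p := 2) (by norm_num)
    (f := fun n y => φ n y i) (fun n => (hφc n).aestronglyMeasurable) hvm
    (tendsto_eLpNorm_coord hφv i)).exists_seq_tendsto_ae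
  -- Let `m → ∞` in `hdiff`, along a subsequence that converges almost everywhere.
  have hbound : ∀ n, eLpNorm (fun y => φ n y i - v y i) 4 μ ≤ C * e n := by
    intro n
    refine (Lp.eLpNorm_lim_le_liminf_eLpNorm (f := fun k y => φ n y i - φ (ns k) y i)
      (fun k => ((hφc n).sub (hφc _)).aestronglyMeasurable) _ ?_).trans ?_
    · filter_upwards [hlim] with y hy using tendsto_const_nhds.sub hy
    · have h1 : Tendsto (fun k => C * (e n + e (ns k))) atTop (𝓝 (C * (e n + 0))) :=
        ENNReal.Tendsto.const_mul (tendsto_const_nhds.add (he0.comp hns.tendsto_atTop))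
          (Or.inr hC)
      rw [add_zero] at h1
      rw [← h1.liminf_eq]
      exact liminf_le_liminf (Filter.Eventually.of_forall fun k => hdiff n (ns k))
  have hefin : ∀ n, e n ≠ ⊤ := fun n =>
    ENNReal.sum_ne_top.2 fun j _ => ((hJm n j).sub (hv.memLp_grad i j)).2.ne
  constructor
  · have h0 : MemLp (fun y => φ 0 y i - v y i) 4 μ :=
      ⟨(hφc 0).aestronglyMeasurable.sub hvm,
        (hbound 0).trans_lt (ENNReal.mul_lt_top hC.lt_top (hefin 0).lt_top)⟩
    have h1 := (hφ4 0).sub h0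
    refine h1.ae_eq (ae_of_all _ fun y => ?_)
    simp
  · have h1 := ENNReal.Tendsto.const_mul he0 (Or.inr hC)
    rw [mul_zero] at h1
    exact tendsto_of_tendsto_of_tendsto_of_le_of_le tendsto_const_nhds h1 (fun _ => zero_le) hbound

instance holderTriple_four_four_two : ENNReal.HolderTriple 4 4 2 where
  inv_add_inv_eq_inv := by
    rw [← ENNReal.toReal_eq_toReal_iff' (by simp) (by simp), ENNReal.toReal_add (by simp) (by simp)]
    simp only [ENNReal.toReal_inv, ENNReal.toReal_ofNat]
    norm_num

/-- `∫ (v · ∇) v · v = 0` for solenoidal `v` in `H¹₀`, in dimension two or three. The squares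
`|φ|²` of the smooth approximants are test functions for `div v = 0`, which gives `∫ (v · ∇) φ · φ
= 0`; the limit is taken using `φ → v` in `L⁴` and `∇φ → ∇v` in `L²`. -/
lemma MemH10.integral_convective_eq_zero (hd : d = 2 ∨ d = 3) {Ω : Set (Vec d)}
    (hΩ : Bornology.IsBounded Ω) {v : Vec d → Vec d}
    {G : Vec d → Tensor d} (hv : MemH10 Ω v G)
    (hdiv : ∀ᵐ y ∂(volume.restrict Ω), (G y).trace = 0) :
    ∫ y in Ω, ∑ i, ∑ j, v y j * G y i j * v y i = 0 := by
  obtain ⟨φ, hφ, hφv, hφG⟩ := hv.approx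
  set μ := volume.restrict Ω with hμ
  have h4 := fun i => MemH10.tendsto_eLpNorm_four hd hΩ hv.toMemH1 hφ hφv hφG i
  have hJm : ∀ n i j, MemLp (fun y => jacobian (φ n) y i j) 2 μ := fun n i j =>
    memLp_of_continuous_of_hasCompactSupport (continuous_jacobian_apply (hφ n).1 i j)
      (hasCompactSupport_jacobian_apply (hφ n).2.1 i j) _ _
  have hφ4 : ∀ n i, MemLp (fun y => φ n y i) 4 μ := fun n i =>
    memLp_of_continuous_of_hasCompactSupport
      (contDiff_apply_of_contDiff (hφ n).1 i).continuous (hasCompactSupport_apply (hφ n).2.1 i) _ _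
  have hvφ : ∀ n i j, MemLp (fun y => v y j * φ n y i) 2 μ := fun n i j =>
    MemLp.mul' (hφ4 n i) (h4 j).1
  have hvv : ∀ i j, MemLp (fun y => v y j * v y i) 2 μ := fun i j => MemLp.mul' (h4 i).1 (h4 j).1
  have hvφv : ∀ i j, Tendsto (fun n => eLpNorm (fun y => v y j * φ n y i - v y j * v y i) 2 μ)
      atTop (𝓝 0) := by
    intro i j
    have h1 := ENNReal.Tendsto.const_mul (a := eLpNorm (fun y => v y j) 4 μ) (h4 i).2
      (Or.inr (h4 j).1.2.ne)
    rw [mul_zero] at h1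
    refine tendsto_of_tendsto_of_tendsto_of_le_of_le tendsto_const_nhds h1 (fun _ => zero_le)
      fun n => ?_
    have h2 := eLpNorm_smul_le_mul_eLpNorm (p := 4) (q := 4) (r := 2) ((hφ4 n i).sub (h4 i).1).1
      (h4 j).1.1
    refine le_trans (le_of_eq ?_) h2
    congr 1
    ext y
    simp [mul_sub]
  have hlim : ∀ i j, Tendsto (fun n => ∫ y, (v y j * φ n y i) * jacobian (φ n) y i j ∂μ) atTop
      (𝓝 (∫ y, (v y j * v y i) * G y i j ∂μ)) := fun i j =>
    tendsto_integral_mul_of_tendsto_eLpNorm (fun n => hvφ n i j) (fun n => hJm n i j) (hvv i j)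
      (hv.memLp_grad i j) (hvφv i j) (hφG i j)
  have hint : ∀ n i j, Integrable (fun y => (v y j * φ n y i) * jacobian (φ n) y i j) μ :=
    fun n i j => (hvφ n i j).integrable_mul (hJm n i j)
  have hzero : ∀ n, ∑ i, ∑ j, ∫ y, (v y j * φ n y i) * jacobian (φ n) y i j ∂μ = 0 := by
    intro n
    set ψ : Vec d → ℝ := fun y => ∑ i, φ n y i ^ 2 with hψ
    have hψs : ContDiff ℝ ∞ ψ :=
      ContDiff.sum fun i _ => (contDiff_apply_of_contDiff (hφ n).1 i).pow 2
    have hψsub : Function.support ψ ⊆ Function.support (φ n) := by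
      intro y hy h0
      exact hy (by simp [hψ, h0])
    have hψc : HasCompactSupport ψ := (hφ n).2.1.mono hψsub
    have hψΩ : tsupport ψ ⊆ Ω := (closure_mono hψsub).trans (hφ n).2.2
    have hder : ∀ y j, fderiv ℝ ψ y (EuclideanSpace.single j 1)
        = ∑ i, 2 * (φ n y i * jacobian (φ n) y i j) := by
      intro y j
      have hdi : ∀ i, DifferentiableAt ℝ (fun z => φ n z i) y := fun i =>
        (contDiff_apply_of_contDiff (hφ n).1 i).differentiable (by simp) y
      have h1 : fderiv ℝ ψ y = ∑ i, fderiv ℝ (fun z => φ n z i ^ 2) y :=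
        fderiv_fun_sum fun i _ => (hdi i).pow 2
      rw [h1, sum_apply]
      refine Finset.sum_congr rfl fun i _ => ?_
      rw [fderiv_fun_pow 2 (hdi i)]
      simp only [smul_apply, smul_eq_mul,
        fderiv_apply_coord ((hφ n).1.differentiable (by simp) y)]
      simp
      ring
    have hGψ : ∀ j, Integrable (fun y => G y j j * ψ y) μ := fun j =>
      (hv.memLp_grad j j).integrable_mul
        (memLp_of_continuous_of_hasCompactSupport hψs.continuous hψc 2 μ)
    have hw : ∀ j, ∑ i, 2 * ∫ y, (v y j * φ n y i) * jacobian (φ n) y i j ∂μ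
        = - ∫ y, G y j j * ψ y ∂μ := by
      intro j
      rw [← hv.weakGradient ψ hψs hψc hψΩ j j]
      simp_rw [hder, Finset.mul_sum, ← integral_const_mul]
      rw [← integral_finsetSum _ fun i _ => (hint n i j).const_mul 2]
      refine integral_congr_ae (ae_of_all _ fun y => ?_)
      exact Finset.sum_congr rfl fun i _ => by ring
    have htr : ∑ j, ∫ y, G y j j * ψ y ∂μ = 0 := by
      rw [← integral_finsetSum _ fun j _ => hGψ j]
      refine integral_eq_zero_of_ae ?_
      filter_upwards [hdiv] with y hy
      rw [← Finset.sum_mul]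
      have : ∑ j, G y j j = (G y).trace := rfl
      rw [this, hy, zero_mul]
      rfl
    have h5 : ∑ j, ∑ i, 2 * ∫ y, (v y j * φ n y i) * jacobian (φ n) y i j ∂μ = 0 := by
      simp_rw [hw, Finset.sum_neg_distrib, htr, neg_zero]
    rw [Finset.sum_comm]
    simp_rw [← Finset.mul_sum] at h5
    linarith
  have hsum := tendsto_finsetSum Finset.univ fun i (_ : i ∈ Finset.univ) =>
    tendsto_finsetSum Finset.univ fun j (_ : j ∈ Finset.univ) => hlim i j
  simp only [hzero] at hsum
  have h0 := tendsto_nhds_unique hsum tendsto_const_nhds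
  rw [← h0]
  have hI : ∀ i j, Integrable (fun y => (v y j * v y i) * G y i j) μ := fun i j =>
    (hvv i j).integrable_mul (hv.memLp_grad i j)
  have e : ∀ y, ∑ i, ∑ j, v y j * G y i j * v y i = ∑ i, ∑ j, (v y j * v y i) * G y i j := fun y =>
    Finset.sum_congr rfl fun i _ => Finset.sum_congr rfl fun j _ => by ring
  simp_rw [e]
  rw [integral_finsetSum _ fun i _ => integrable_finsetSum _ fun j _ => hI i j]
  exact Finset.sum_congr rfl fun i _ => integral_finsetSum _ fun j _ => hI i j

end FSI

namespace FSI

open scoped ENNReal NNReal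

/-! ### Tensor-valued functions and the determinant -/

variable {d : ℕ}

lemma tensor_eq_sum (A : Tensor d) : A = ∑ i, ∑ j, A i j • Matrix.single i j (1 : ℝ) := by
  conv_lhs => rw [Matrix.matrix_eq_sum_single A]
  simp

/-- The entries of a tensor, as continuous linear forms. -/
noncomputable def entryL (i j : Fin d) : Tensor d →L[ℝ] ℝ :=
  LinearMap.toContinuousLinearMap (Matrix.entryLinearMap ℝ ℝ i j)

lemma aestronglyMeasurable_tensor {α : Type*} {m : MeasurableSpace α} {μ : Measure α}
    {M : α → Tensor d} (h : ∀ i j, AEStronglyMeasurable (fun z => M z i j) μ) :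
    AEStronglyMeasurable M μ := by
  have e : M = fun z => ∑ i, ∑ j, M z i j • Matrix.single i j (1 : ℝ) :=
    funext fun z => tensor_eq_sum (M z)
  rw [e]
  exact Finset.aestronglyMeasurable_fun_sum _ fun i _ =>
    Finset.aestronglyMeasurable_fun_sum _ fun j _ => (h i j).smul_const _

lemma memLp_tensor {α : Type*} {m : MeasurableSpace α} {μ : Measure α} {q : ℝ≥0∞}
    {M : α → Tensor d} (h : ∀ i j, MemLp (fun z => M z i j) q μ) : MemLp M q μ := by
  have h1 : MemLp (fun z => ∑ i, ∑ j, ‖M z i j‖) q μ :=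
    memLp_finsetSum _ fun i _ => memLp_finsetSum _ fun j _ => (h i j).norm
  refine h1.mono' (aestronglyMeasurable_tensor fun i j => (h i j).1) (ae_of_all _ fun z => ?_)
  have h0 : ∀ i, 0 ≤ ∑ j, ‖M z i j‖ := fun i => Finset.sum_nonneg fun j _ => norm_nonneg _
  refine (Matrix.norm_le_iff (Finset.sum_nonneg fun i _ => h0 i)).2 fun i j => ?_
  exact (Finset.single_le_sum (f := fun j => ‖M z i j‖) (fun j _ => norm_nonneg _)
    (Finset.mem_univ j)).trans
      (Finset.single_le_sum (f := fun i => ∑ j, ‖M z i j‖) (fun i _ => h0 i) (Finset.mem_univ i))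

lemma contDiff_det : ContDiff ℝ 1 (fun A : Tensor d => A.det) := by
  have h : (fun A : Tensor d => A.det)
      = fun A => ∑ σ : Equiv.Perm (Fin d), Equiv.Perm.sign σ • ∏ i, entryL (σ i) i A := by
    ext A; rw [Matrix.det_apply]; rfl
  rw [h]
  refine ContDiff.sum fun σ _ => ?_
  exact (contDiff_prod fun i _ => (entryL (σ i) i).contDiff).const_smul (Equiv.Perm.sign σ)

/-- Jacobi's formula in the direction `G * F`. -/
lemma fderiv_det_mul (G F : Tensor d) :
    fderiv ℝ (fun A : Tensor d => A.det) F (G * F) = G.trace * F.det := by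
  have h1 : HasDerivAt (fun s : ℝ => F + s • (G * F)) (G * F) 0 := by
    have := ((hasDerivAt_id (0 : ℝ)).smul_const (G * F)).const_add F
    rw [one_smul] at this
    exact this
  have h2 : HasFDerivAt (fun A : Tensor d => A.det)
      (fderiv ℝ (fun A : Tensor d => A.det) F) (F + (0 : ℝ) • (G * F)) := by
    rw [zero_smul, add_zero]
    exact (contDiff_det.differentiable (by simp) F).hasFDerivAt
  have h3 := h2.comp_hasDerivAt (0 : ℝ) h1
  have h4 : HasDerivAt (fun s : ℝ => (1 + s • G).det) G.trace 0 := by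
    have e : (fun s : ℝ => (1 + s • G).det)
        = fun s : ℝ => ((1 : Matrix (Fin d) (Fin d) (Polynomial ℝ))
          + (Polynomial.X : Polynomial ℝ) • G.map Polynomial.C).det.eval s := by
      ext s
      rw [← Polynomial.coe_evalRingHom, RingHom.map_det]
      congr 1
      ext i j
      by_cases hij : i = j <;> simp [hij] <;> ring
    rw [e, ← Matrix.derivative_det_one_add_X_smul G]
    exact Polynomial.hasDerivAt _ _
  have h5 : ((fun A : Tensor d => A.det) ∘ fun s : ℝ => F + s • (G * F))
      = fun s : ℝ => (1 + s • G).det * F.det := by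
    ext s
    simp only [Function.comp_apply]
    rw [← Matrix.det_mul, add_mul, one_mul, Matrix.smul_mul]
  rw [h5] at h3
  exact h3.unique (h4.mul_const _)

lemma ddot_piolaKirchhoff (Ψ : Tensor d → ℝ) (F H : Tensor d) :
    ddot (piolaKirchhoff Ψ F) H = fderiv ℝ Ψ F H := by
  conv_rhs => rw [tensor_eq_sum H]
  simp only [map_sum, map_smul, smul_eq_mul, ddot, piolaKirchhoff, Matrix.of_apply]
  exact Finset.sum_congr rfl fun i _ => Finset.sum_congr rfl fun j _ => mul_comm _ _

/-! ### Families of bi-Lipschitz maps depending measurably on time -/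

variable {T : ℝ} {L K : ℝ≥0} {U Ω : Set (Vec d)} {x : ℝ → Vec d → Vec d}
  {y : ℝ × Vec d → Vec d}

/-- If `y` is a jointly measurable representative of the motion `x`, then the preimage of a set
under `(t, X) ↦ (t, y (t, X))` has at most `K ^ d` times its space-time volume. -/
lemma map_prodMk_le {τ : Measure ℝ} [SFinite τ] (hx : ∀ᵐ t ∂τ, BiLip L K U Ω (x t))
    (hy : AEStronglyMeasurable y (τ.prod (volume.restrict U)))
    (hyx : ∀ᵐ t ∂τ, ∀ᵐ X ∂(volume.restrict U), y (t, X) = x t X) :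
    (τ.prod (volume.restrict U)).map (fun z => (z.1, y z))
      ≤ ((K : ℝ≥0∞) ^ d) • τ.prod (volume.restrict Ω) := by
  have hmk := hy.ae_eq_mk
  set y' := hy.mk y
  have hy' : Measurable y' := hy.stronglyMeasurable_mk.measurable
  have hcongr : (fun z : ℝ × Vec d => (z.1, y z))
      =ᵐ[τ.prod (volume.restrict U)] fun z => (z.1, y' z) := by
    filter_upwards [hmk] with z hz
    rw [hz]
  rw [Measure.map_congr hcongr]
  refine Measure.le_iff.2 fun A hA => ?_
  have hm : Measurable fun z : ℝ × Vec d => (z.1, y' z) := measurable_fst.prodMk hy'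
  rw [Measure.map_apply hm hA, Measure.prod_apply (hm hA), Measure.smul_apply,
    Measure.prod_apply hA, smul_eq_mul, ← lintegral_const_mul _ (measurable_measure_prodMk_left hA)]
  refine lintegral_mono_ae ?_
  filter_upwards [hx, hyx, Measure.ae_ae_of_ae_prod hmk] with t h1 h2 h3
  have h4 : volume.restrict U (Prod.mk t ⁻¹' ((fun z : ℝ × Vec d => (z.1, y' z)) ⁻¹' A))
      = volume.restrict U (x t ⁻¹' (Prod.mk t ⁻¹' A)) := by
    refine measure_congr ?_
    filter_upwards [h2, h3] with X h5 h6
    have h7 : y' (t, X) = x t X := h6.symm.trans h5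
    change ((t, y' (t, X)) ∈ A) = ((t, x t X) ∈ A)
    rw [h7]
  have hAt : MeasurableSet (Prod.mk t ⁻¹' A) := measurable_prodMk_left hA
  rw [h4, ← Measure.map_apply_of_aemeasurable h1.aemeasurable hAt]
  exact h1.map_le _

lemma aemeasurable_prodMk {τ : Measure ℝ} [SFinite τ]
    (hy : AEStronglyMeasurable y (τ.prod (volume.restrict U))) :
    AEMeasurable (fun z : ℝ × Vec d => (z.1, y z)) (τ.prod (volume.restrict U)) :=
  measurable_fst.aemeasurable.prodMk hy.aemeasurable

lemma memLp_comp_prodMk {τ : Measure ℝ} [SFinite τ] (hx : ∀ᵐ t ∂τ, BiLip L K U Ω (x t))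
    (hy : AEStronglyMeasurable y (τ.prod (volume.restrict U)))
    (hyx : ∀ᵐ t ∂τ, ∀ᵐ X ∂(volume.restrict U), y (t, X) = x t X) {g : ℝ × Vec d → ℝ}
    (hg : MemLp g 2 (τ.prod (volume.restrict Ω))) :
    MemLp (fun z => g (z.1, y z)) 2 (τ.prod (volume.restrict U)) := by
  have h1 : MemLp g 2 ((τ.prod (volume.restrict U)).map (fun z => (z.1, y z))) :=
    hg.of_measure_le_smul (by simp) (map_prodMk_le hx hy hyx)
  exact h1.comp_of_map (aemeasurable_prodMk hy)

/-- The deformation gradient has a jointly measurable representative, the upper limit of the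
difference quotients of a jointly measurable representative of the motion. -/
lemma exists_measurable_jacobian {τ : Measure ℝ} [SFinite τ]
    (hx : ∀ᵐ t ∂τ, BiLip L K U Ω (x t))
    (hy : AEStronglyMeasurable y (τ.prod (volume.restrict U)))
    (hyx : ∀ᵐ t ∂τ, ∀ᵐ X ∂(volume.restrict U), y (t, X) = x t X) :
    ∃ F : ℝ × Vec d → Tensor d, (∀ i j, Measurable fun z => F z i j) ∧
      ∀ᵐ t ∂τ, ∀ᵐ X ∂(volume.restrict U), F (t, X) = jacobian (x t) X := by
  have hmk := hy.ae_eq_mk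
  set y' := hy.mk y
  have hy' : Measurable y' := hy.stronglyMeasurable_mk.measurable
  set c : ℕ → ℝ := fun n => (n : ℝ) + 1 with hc
  set e : ℕ → Fin d → Vec d := fun n j => (c n)⁻¹ • EuclideanSpace.single j (1 : ℝ) with he
  set q : Fin d → Fin d → ℕ → ℝ × Vec d → ℝ := fun i j n z =>
    c n * (y' (z.1, z.2 + e n j) i - y' z i) with hq
  have hqm : ∀ i j n, Measurable (q i j n) := by
    intro i j n
    have hi : Measurable fun w : Vec d => w i := (EuclideanSpace.proj (𝕜 := ℝ) i).measurable
    have h1 : Measurable fun z : ℝ × Vec d => y' (z.1, z.2 + e n j) :=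
      hy'.comp (measurable_fst.prodMk (measurable_snd.add_const _))
    exact ((hi.comp h1).sub (hi.comp hy')).const_mul _
  refine ⟨fun z => Matrix.of fun i j => limsup (fun n => q i j n z) atTop, fun i j =>
    Measurable.limsup (hqm i j), ?_⟩
  filter_upwards [hx, hyx, Measure.ae_ae_of_ae_prod hmk] with t h1 h2 h3
  have h4 : ∀ᵐ X ∂(volume : Measure (Vec d)), X ∈ U → y' (t, X) = x t X := by
    rw [← ae_restrict_iff' h1.isOpen.measurableSet]
    filter_upwards [h2, h3] with X h5 h6
    rw [← h6, h5]
  have h5 : ∀ᵐ X ∂(volume : Measure (Vec d)), ∀ n j,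
      X + e n j ∈ U → y' (t, X + e n j) = x t (X + e n j) := by
    rw [ae_all_iff]; intro n
    rw [ae_all_iff]; intro j
    exact (measurePreserving_add_right volume (e n j)).quasiMeasurePreserving.ae h4
  filter_upwards [ae_restrict_of_ae h4, ae_restrict_of_ae h5, h1.ae_differentiableAt,
    ae_restrict_mem h1.isOpen.measurableSet] with X h6 h7 h8 hXU
  ext i j
  have hcinf : Tendsto (fun n => ‖c n‖) atTop atTop :=
    tendsto_norm_atTop_atTop.comp (tendsto_natCast_atTop_atTop.atTop_add tendsto_const_nhds)
  have hlim := h8.hasFDerivAt.lim (EuclideanSpace.single j (1 : ℝ)) hcinf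
  have he0 : Tendsto (fun n => X + e n j) atTop (𝓝 X) := by
    have h9 : Tendsto (fun n => (c n)⁻¹) atTop (𝓝 0) :=
      tendsto_inv_atTop_zero.comp (tendsto_natCast_atTop_atTop.atTop_add tendsto_const_nhds)
    simpa using (h9.smul_const (EuclideanSpace.single j (1 : ℝ))).const_add X
  have hlim' : Tendsto (fun n => q i j n (t, X)) atTop (𝓝 (jacobian (x t) X i j)) := by
    have h10 := ((EuclideanSpace.proj (𝕜 := ℝ) i).continuous.tendsto _).comp hlim
    refine h10.congr' ?_
    filter_upwards [he0 (h1.isOpen.mem_nhds hXU)] with n hn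
    simp only [hq, h6 hXU, h7 n j hn]
    simp [he]
  rw [Matrix.of_apply]
  exact hlim'.limsup_eq

end FSI

namespace FSI

open scoped ENNReal NNReal

/-! ### Evolution of the deformation gradient -/

lemma integrable_of_memLp_two {α E : Type*} {m : MeasurableSpace α} {μ : Measure α}
    [IsFiniteMeasure μ] [NormedAddCommGroup E] {f : α → E} (hf : MemLp f 2 μ) : Integrable f μ :=
  hf.integrable one_le_two

namespace Data

variable {d : ℕ} {D : Data d} {u : ℝ → Vec d → Vec d} {p : ℝ → Vec d → ℝ}
  {x : ℝ → Vec d → Vec d} {Gu : ℝ → Vec d → Tensor d} {ut a : ℝ → Vec d → Vec d}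

lemma IsMotion.exists_biLip (h : D.IsMotion x) :
    ∃ L K : ℝ≥0, ∀ t ∈ Icc 0 D.T, BiLip L K D.ΩX D.Ω (x t) := by
  obtain ⟨L, hL⟩ := h.lipschitz
  obtain ⟨c, hc, hcx⟩ := h.lipschitz_inverse
  refine ⟨L.toNNReal, (c⁻¹).toNNReal, fun t ht => ⟨D.isOpen_ΩX, D.isOpen_Ω.measurableSet,
    h.mapsTo t ht, LipschitzOnWith.of_dist_le_mul fun X hX Y hY => ?_, fun X hX Y hY => ?_⟩⟩
  · rw [dist_eq_norm, dist_eq_norm]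
    exact (hL t ht X hX Y hY).trans
      (mul_le_mul_of_nonneg_right (Real.le_coe_toNNReal L) (norm_nonneg _))
  · rw [dist_eq_norm, dist_eq_norm, Real.coe_toNNReal _ (inv_nonneg.2 hc.le),
      le_inv_mul_iff₀ hc]
    exact hcx t ht X hX Y hY

variable (D) in
lemma isFiniteMeasure_Ω : IsFiniteMeasure (volume.restrict D.Ω) :=
  ⟨by simpa using D.bounded_Ω.measure_lt_top⟩

lemma IsMotion.isFiniteMeasure_ΩX (h : D.IsMotion x) :
    IsFiniteMeasure (volume.restrict D.ΩX) := by
  obtain ⟨L, K, hLK⟩ := h.exists_biLip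
  have h0 := hLK 0 (left_mem_Icc.2 D.T_pos.le)
  refine ⟨?_⟩
  rw [Measure.restrict_apply_univ]
  calc volume D.ΩX ≤ volume (D.ΩX ∩ x 0 ⁻¹' D.Ω) :=
        measure_mono fun X hX => ⟨hX, h0.mapsTo hX⟩
    _ ≤ (K : ℝ≥0∞) ^ d * volume D.Ω := volume_inter_preimage_le h0.dist_le _
    _ < ⊤ := ENNReal.mul_lt_top (by simp) D.bounded_Ω.measure_lt_top

namespace IsWeakSolution

lemma ae_trace_eq_zero (h : D.IsWeakSolution u p x Gu ut a) :
    ∀ᵐ t ∂(volume.restrict (Icc 0 D.T)), ∀ᵐ y ∂(volume.restrict D.Ω), (Gu t y).trace = 0 := by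
  filter_upwards [h.incompressible, h.velocity_mem] with t h1 h2
  have h3 : MemLp (fun y => (Gu t y).trace) 2 (volume.restrict D.Ω) :=
    memLp_finsetSum _ fun i _ => h2.memLp_grad i i
  have h4 := neg_eq_zero.1 (h1 _ h3)
  have h5 : Integrable (fun y => (Gu t y).trace * (Gu t y).trace) (volume.restrict D.Ω) :=
    h3.integrable_mul h3
  have h6 := (integral_eq_zero_iff_of_nonneg (fun y => mul_self_nonneg _) h5).1 h4
  filter_upwards [h6] with y hy
  exact mul_self_eq_zero.1 hy

lemma ae_mem_Icc : ∀ᵐ t ∂(volume.restrict (Icc 0 D.T)), t ∈ Icc 0 D.T :=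
  ae_restrict_mem measurableSet_Icc

/-- The velocity gradient in reference coordinates, `∇_X u = (∇u ∘ x) F`, has a representative which
is jointly measurable and square integrable in space-time. -/
lemma exists_velocityGradient (h : D.IsWeakSolution u p x Gu ut a) :
    ∃ H : ℝ → Vec d → Tensor d,
      MemLp (fun z : ℝ × Vec d => H z.1 z.2) 2
        ((volume.restrict (Icc 0 D.T)).prod (volume.restrict D.ΩX)) ∧
      ∀ᵐ t ∂(volume.restrict (Icc 0 D.T)), ∀ᵐ X ∂(volume.restrict D.ΩX),
        H t X = Gu t (x t X) * jacobian (x t) X := by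
  obtain ⟨L, K, hLK⟩ := h.motion.exists_biLip
  have hfin := h.motion.isFiniteMeasure_ΩX
  set y : ℝ × Vec d → Vec d := fun z => primitive (x 0) (fun t X => u t (x t X)) z.1 z.2
  have hx : ∀ᵐ t ∂(volume.restrict (Icc 0 D.T)), BiLip L K D.ΩX D.Ω (x t) :=
    ae_mem_Icc.mono fun t ht => hLK t ht
  have hy : AEStronglyMeasurable y ((volume.restrict (Icc 0 D.T)).prod (volume.restrict D.ΩX)) :=
    aestronglyMeasurable_primitive (h.kinematic.memLp 0 (left_mem_Icc.2 D.T_pos.le)).1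
      h.kinematic.memLp_deriv.1
  have hyx : ∀ᵐ t ∂(volume.restrict (Icc 0 D.T)), ∀ᵐ X ∂(volume.restrict D.ΩX),
      y (t, X) = x t X := by
    filter_upwards [ae_mem_Icc] with t ht
    filter_upwards [h.kinematic.eq_primitive t ht] with X hX using hX.symm
  obtain ⟨F, hFm, hF⟩ := exists_measurable_jacobian hx hy hyx
  have hFb : ∀ i j, ∀ᵐ z ∂((volume.restrict (Icc 0 D.T)).prod (volume.restrict D.ΩX)),
      ‖F z i j‖ ≤ L := by
    intro i j
    refine (Measure.ae_prod_iff_ae_ae (measurableSet_le (hFm i j).norm measurable_const)).2 ?_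
    filter_upwards [hF, hx] with t h1 h2
    filter_upwards [h1, ae_restrict_mem D.isOpen_ΩX.measurableSet] with X h3 h4
    rw [h3]
    exact abs_jacobian_apply_le h2.isOpen h2.lipschitz h4 i j
  refine ⟨fun t X => Gu t (y (t, X)) * F (t, X), memLp_tensor fun i j => ?_, ?_⟩
  · simp only [Matrix.mul_apply]
    refine memLp_finsetSum _ fun k _ => ?_
    have h1 := memLp_comp_prodMk hx hy hyx (h.gradient_memLp i k)
    refine MemLp.of_le_mul (c := L) h1 (h1.1.mul (hFm k j).aestronglyMeasurable) ?_
    filter_upwards [hFb k j] with z hz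
    rw [norm_mul, mul_comm]
    exact mul_le_mul_of_nonneg_right hz (norm_nonneg _)
  · filter_upwards [hF, hyx] with t h1 h2
    filter_upwards [h1, h2] with X h3 h4
    rw [h3, h4]

lemma memLp_jacobian {L K : ℝ≥0} {U Ω : Set (Vec d)} {f : Vec d → Vec d}
    [IsFiniteMeasure (volume.restrict U)] (h : BiLip L K U Ω f) (i j : Fin d) :
    MemLp (fun X => jacobian f X i j) 2 (volume.restrict U) := by
  simpa using MemLp.mul_jacobian h.isOpen h.lipschitz (memLp_const (1 : ℝ)) i j

/-- The deformation gradient is transported by the velocity gradient: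
`F(t) = F(0) + ∫₀ᵗ ∇_X u ds`. This is the weak gradient of `x(t) = x(0) + ∫₀ᵗ u ∘ x ds`. -/
lemma jacobian_eq_primitive (h : D.IsWeakSolution u p x Gu ut a) {H : ℝ → Vec d → Tensor d}
    (hH : MemLp (fun z : ℝ × Vec d => H z.1 z.2) 2
        ((volume.restrict (Icc 0 D.T)).prod (volume.restrict D.ΩX)))
    (hHx : ∀ᵐ t ∂(volume.restrict (Icc 0 D.T)), ∀ᵐ X ∂(volume.restrict D.ΩX),
        H t X = Gu t (x t X) * jacobian (x t) X) {t : ℝ} (ht : t ∈ Icc 0 D.T) :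
    jacobian (x t) =ᵐ[volume.restrict D.ΩX] primitive (jacobian (x 0)) H t := by
  obtain ⟨L, K, hLK⟩ := h.motion.exists_biLip
  have hfin := h.motion.isFiniteMeasure_ΩX
  have h0 : (0 : ℝ) ∈ Icc 0 D.T := left_mem_Icc.2 D.T_pos.le
  have hHi := integrable_of_memLp_two hH
  have hVi : Integrable (fun z : ℝ × Vec d => u z.1 (x z.1 z.2))
      ((volume.restrict (Icc 0 D.T)).prod (volume.restrict D.ΩX)) :=
    h.kinematic.memLp_deriv.integrable (by norm_num)
  have hHij : ∀ i j, MemLp (fun z : ℝ × Vec d => H z.1 z.2 i j) 2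
      ((volume.restrict (Icc 0 D.T)).prod (volume.restrict D.ΩX)) := fun i j =>
    (entryL i j).comp_memLp' hH
  have hentry : ∀ i j, ∀ᵐ X ∂(volume.restrict D.ΩX),
      primitive (jacobian (x 0)) H t X i j = jacobian (x 0) X i j + ∫ s in 0..t, H s X i j := by
    intro i j
    filter_upwards [ae_intervalIntegrable (wt := H) hHi] with X hX
    have := (entryL i j).intervalIntegral_comp_comm (hX t ht)
    change ∫ s in 0..t, H s X i j = _ at this
    rw [this]
    rfl
  -- It suffices to test the difference of both sides against smooth functions `φ`.
  have key : ∀ i j, ∀ᵐ X ∂(volume.restrict D.ΩX),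
      jacobian (x t) X i j - (jacobian (x 0) X i j + ∫ s in 0..t, H s X i j) = 0 := by
    intro i j
    have hHI : Integrable (fun X => ∫ s in 0..t, H s X i j) (volume.restrict D.ΩX) := by
      have h1 : Integrable (fun z : ℝ × Vec d => H z.1 z.2 i j)
          ((volume.restrict (Ioc 0 t)).prod (volume.restrict D.ΩX)) := by
        refine ((hHij i j).integrable (by norm_num)).mono_measure (Measure.prod_mono ?_ le_rfl)
        exact Measure.restrict_mono (Ioc_subset_Icc_self.trans (Icc_subset_Icc_right ht.2)) le_rfl
      simpa only [intervalIntegral.integral_of_le ht.1] using h1.integral_prod_right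
    have hJI : ∀ s ∈ Icc 0 D.T, Integrable (fun X => jacobian (x s) X i j)
        (volume.restrict D.ΩX) := fun s hs =>
      (memLp_jacobian (hLK s hs) i j).integrable (by norm_num)
    have hgI := (hJI t ht).sub ((hJI 0 h0).add hHI)
    rw [ae_restrict_iff' D.isOpen_ΩX.measurableSet]
    refine D.isOpen_ΩX.ae_eq_zero_of_integral_contDiff_smul_eq_zero
      (IntegrableOn.locallyIntegrableOn hgI) fun φ hφ hφc hφU => ?_
    have hφ2 : MemLp φ 2 (volume.restrict D.ΩX) :=
      memLp_of_continuous_of_hasCompactSupport hφ.continuous hφc _ _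
    have hb2 : MemLp (fun X => fderiv ℝ φ X (EuclideanSpace.single j 1)) 2
        (volume.restrict D.ΩX) :=
      memLp_of_continuous_of_hasCompactSupport (continuous_fderiv_apply hφ _)
        (hasCompactSupport_fderiv_apply hφc _) _ _
    have hweak : ∀ s ∈ Icc 0 D.T,
        ∫ X in D.ΩX, x s X i * fderiv ℝ φ X (EuclideanSpace.single j 1)
          = - ∫ X in D.ΩX, jacobian (x s) X i j * φ X := fun s hs =>
      hasWeakGradient_of_lipschitzOnWith D.isOpen_ΩX (hLK s hs).lipschitz φ hφ hφc hφU i j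
    have hxI : ∀ s ∈ Icc 0 D.T, Integrable
        (fun X => x s X i * fderiv ℝ φ X (EuclideanSpace.single j 1)) (volume.restrict D.ΩX) :=
      fun s hs => (MemLp.coord (h.kinematic.memLp s hs) i).integrable_mul hb2
    have hJφ : ∀ s ∈ Icc 0 D.T, Integrable (fun X => jacobian (x s) X i j * φ X)
        (volume.restrict D.ΩX) := fun s hs =>
      (memLp_jacobian (hLK s hs) i j).integrable_mul hφ2
    have hVb : Integrable (fun z : ℝ × Vec d =>
        u z.1 (x z.1 z.2) i * fderiv ℝ φ z.2 (EuclideanSpace.single j 1))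
        ((volume.restrict (Icc 0 D.T)).prod (volume.restrict D.ΩX)) :=
      (MemLp.coord h.kinematic.memLp_deriv i).integrable_mul (memLp_comp_snd hb2)
    have hHφ : Integrable (fun z : ℝ × Vec d => H z.1 z.2 i j * φ z.2)
        ((volume.restrict (Icc 0 D.T)).prod (volume.restrict D.ΩX)) :=
      (hHij i j).integrable_mul (memLp_comp_snd hφ2)
    have hdiff : (∫ X in D.ΩX, x t X i * fderiv ℝ φ X (EuclideanSpace.single j 1))
        - ∫ X in D.ΩX, x 0 X i * fderiv ℝ φ X (EuclideanSpace.single j 1)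
        = - ∫ X in D.ΩX, (∫ s in 0..t, H s X i j) * φ X := by
      rw [← integral_sub (hxI t ht) (hxI 0 h0)]
      have e1 : ∫ X in D.ΩX, (x t X i * fderiv ℝ φ X (EuclideanSpace.single j 1)
            - x 0 X i * fderiv ℝ φ X (EuclideanSpace.single j 1))
          = ∫ X in D.ΩX, (∫ s in 0..t,
              u s (x s X) i * fderiv ℝ φ X (EuclideanSpace.single j 1)) := by
        refine integral_congr_ae ?_
        filter_upwards [h.kinematic.eq_primitive t ht,
          ae_intervalIntegrable (wt := fun s X => u s (x s X)) hVi] with X hX hXi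
        have h3 := (EuclideanSpace.proj i : Vec d →L[ℝ] ℝ).intervalIntegral_comp_comm (hXi t ht)
        simp only [PiLp.proj_apply] at h3
        rw [intervalIntegral.integral_mul_const, h3, hX]
        simp
        ring
      have e2 : ∀ᵐ s ∂(volume.restrict (Icc 0 D.T)),
          ∫ X in D.ΩX, u s (x s X) i * fderiv ℝ φ X (EuclideanSpace.single j 1)
            = ∫ X in D.ΩX, -(H s X i j * φ X) := by
        filter_upwards [h.velocity_mem, hHx, ae_mem_Icc] with s h1 h2 h3
        have h4 := (h1.comp_biLip (hLK s h3)).weakGradient φ hφ hφc hφU i j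
        rw [h4, ← integral_neg]
        refine integral_congr_ae ?_
        filter_upwards [h2] with X hX
        rw [hX]
      rw [e1, integral_intervalIntegral_swap (k := fun s X =>
          u s (x s X) i * fderiv ℝ φ X (EuclideanSpace.single j 1)) hVb ht, ← integral_neg]
      have e3 : ∫ s in 0..t, (∫ X in D.ΩX,
            u s (x s X) i * fderiv ℝ φ X (EuclideanSpace.single j 1))
          = ∫ s in 0..t, (∫ X in D.ΩX, -(H s X i j * φ X)) := by
        rw [intervalIntegral.integral_of_le ht.1, intervalIntegral.integral_of_le ht.1]
        exact integral_congr_ae (ae_restrict_of_ae_restrict_of_subset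
          (Ioc_subset_Icc_self.trans (Icc_subset_Icc_right ht.2)) e2)
      rw [e3, ← integral_intervalIntegral_swap (k := fun s X => -(H s X i j * φ X)) hHφ.neg ht]
      refine integral_congr_ae (ae_of_all _ fun X => ?_)
      simp only [intervalIntegral.integral_neg, intervalIntegral.integral_mul_const]
    rw [hweak t ht, hweak 0 h0] at hdiff
    have hHIφ : Integrable (fun X => (∫ s in 0..t, H s X i j) * φ X) (volume.restrict D.ΩX) := by
      obtain ⟨C, hC⟩ := hφ.continuous.bounded_above_of_compact_support hφc
      exact hHI.mul_bdd hφ.continuous.aestronglyMeasurable (ae_of_all _ hC)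
    rw [← setIntegral_eq_integral_of_forall_compl_eq_zero (s := D.ΩX)]
    · have e : ∀ X, φ X • (jacobian (x t) X i j
          - (jacobian (x 0) X i j + ∫ s in 0..t, H s X i j))
          = jacobian (x t) X i j * φ X
            - (jacobian (x 0) X i j * φ X + (∫ s in 0..t, H s X i j) * φ X) := fun X => by
        rw [smul_eq_mul]; ring
      have e' : ∫ X in D.ΩX, φ X • (jacobian (x t) X i j
          - (jacobian (x 0) X i j + ∫ s in 0..t, H s X i j))
          = ∫ X in D.ΩX, (jacobian (x t) X i j * φ X
            - (jacobian (x 0) X i j * φ X + (∫ s in 0..t, H s X i j) * φ X)) :=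
        integral_congr_ae (ae_of_all _ e)
      have hsum : Integrable (fun X => jacobian (x 0) X i j * φ X
          + (∫ s in 0..t, H s X i j) * φ X) (volume.restrict D.ΩX) := (hJφ 0 h0).add hHIφ
      refine e'.trans ?_
      rw [integral_sub (hJφ t ht) hsum, integral_add (hJφ 0 h0) hHIφ]
      linarith
    · intro X hX
      rw [image_eq_zero_of_notMem_tsupport fun hX' => hX (hφU hX'), zero_smul]
  have hall : ∀ᵐ X ∂(volume.restrict D.ΩX), ∀ i j,
      jacobian (x t) X i j = primitive (jacobian (x 0)) H t X i j := by
    rw [ae_all_iff]; intro i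
    rw [ae_all_iff]; intro j
    filter_upwards [key i j, hentry i j] with X h1 h2
    rw [h2]; linarith
  filter_upwards [hall] with X hX
  ext i j
  exact hX i j

/-- The motion is incompressible: by Jacobi's formula `∂ₜ det F = (div u ∘ x) det F = 0`. -/
lemma det_jacobian_eq (h : D.IsWeakSolution u p x Gu ut a) {t : ℝ} (ht : t ∈ Icc 0 D.T) :
    ∀ᵐ X ∂(volume.restrict D.ΩX), (jacobian (x t) X).det = (jacobian (x 0) X).det := by
  obtain ⟨L, K, hLK⟩ := h.motion.exists_biLip
  have hfin := h.motion.isFiniteMeasure_ΩX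
  have h0 : (0 : ℝ) ∈ Icc 0 D.T := left_mem_Icc.2 D.T_pos.le
  obtain ⟨H, hH, hHx⟩ := h.exists_velocityGradient
  have hHi := integrable_of_memLp_two hH
  have hPm : AEStronglyMeasurable (fun z : ℝ × Vec d => primitive (jacobian (x 0)) H z.1 z.2)
      ((volume.restrict (Icc 0 D.T)).prod (volume.restrict D.ΩX)) :=
    aestronglyMeasurable_primitive
      (aestronglyMeasurable_tensor fun i j => (memLp_jacobian (hLK 0 h0) i j).1) hH.1
  have hzero := ae_ae_swap (ae_eq_prod_of_ae_ae (f := fun z : ℝ × Vec d =>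
      fderiv ℝ (fun A : Tensor d => A.det) (primitive (jacobian (x 0)) H z.1 z.2) (H z.1 z.2))
      (g := fun _ => (0 : ℝ)) (μ := volume.restrict (Icc 0 D.T)) (ρ := volume.restrict D.ΩX)
      (isBoundedBilinearMap_apply.continuous.comp_aestronglyMeasurable
        (((contDiff_det.continuous_fderiv (by simp)).comp_aestronglyMeasurable hPm).prodMk hH.1))
      aestronglyMeasurable_const (by
        filter_upwards [hHx, h.ae_trace_eq_zero, ae_mem_Icc] with s h1 h2 h3
        filter_upwards [h1, (hLK s h3).ae_comp h2, h.jacobian_eq_primitive hH hHx h3]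
          with X h4 h5 h6
        rw [h4, ← h6, fderiv_det_mul, h5, zero_mul]))
  filter_upwards [hzero, ae_intervalIntegrable hHi, h.jacobian_eq_primitive hH hHx ht]
    with X h1 h2 h3
  have h4 := sub_eq_integral_fderiv_primitive contDiff_det (h2 t ht) (jacobian (x 0) X)
  have h5 : ∫ s in 0..t, fderiv ℝ (fun A : Tensor d => A.det)
      (jacobian (x 0) X + ∫ r in 0..s, H r X) (H s X) = 0 := by
    rw [intervalIntegral.integral_of_le ht.1]
    refine integral_eq_zero_of_ae ?_
    exact ae_restrict_of_ae_restrict_of_subset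
      (Ioc_subset_Icc_self.trans (Icc_subset_Icc_right ht.2)) h1
  rw [h3]
  exact sub_eq_zero.1 (h4.trans h5)

end IsWeakSolution

end Data

end FSI

namespace FSI

open scoped ENNReal NNReal

/-! ### Rates of change of the energies -/

/-- The rate of change of a weighted kinetic energy. -/
lemma HasTimeDerivative.integral_mul_norm_sq {d : ℕ} {T : ℝ} (hT : 0 < T) {U : Set (Vec d)}
    [IsFiniteMeasure (volume.restrict U)] {w wt : ℝ → Vec d → Vec d}
    (h : HasTimeDerivative T U w wt) {m : Vec d → ℝ}
    (hm : AEStronglyMeasurable m (volume.restrict U)) {C : ℝ}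
    (hC : ∀ᵐ y ∂(volume.restrict U), ‖m y‖ ≤ C) {t : ℝ} (ht : t ∈ Icc 0 T) :
    IntervalIntegrable (fun s => ∫ y in U, m y * inner ℝ (wt s y) (w s y)) volume 0 t ∧
    (∫ y in U, m y * ‖w t y‖ ^ 2) - ∫ y in U, m y * ‖w 0 y‖ ^ 2
      = 2 * ∫ s in 0..t, ∫ y in U, m y * inner ℝ (wt s y) (w s y) := by
  have hder : ∀ v z : Vec d, fderiv ℝ (fun v : Vec d => ‖v‖ ^ 2) v z = 2 * inner ℝ z v := by
    intro v z
    rw [fderiv_norm_sq_apply]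
    simp [real_inner_comm]
  have h0 : (0 : ℝ) ∈ Icc 0 T := left_mem_Icc.2 hT.le
  have hprim : MemLp (fun z : ℝ × Vec d => primitive (w 0) wt z.1 z.2) 2
      ((volume.restrict (Icc 0 T)).prod (volume.restrict U)) :=
    memLp_primitive hT (h.memLp 0 h0) h.memLp_deriv
  have hCz : ∀ᵐ z ∂((volume.restrict (Icc 0 T)).prod (volume.restrict U)), ‖m z.2‖ ≤ C :=
    Measure.quasiMeasurePreserving_snd.ae hC
  have hk : Integrable (fun z : ℝ × Vec d =>
      m z.2 * fderiv ℝ (fun v : Vec d => ‖v‖ ^ 2) (primitive (w 0) wt z.1 z.2) (wt z.1 z.2))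
      ((volume.restrict (Icc 0 T)).prod (volume.restrict U)) := by
    simp only [hder]
    have h1 : Integrable (fun z : ℝ × Vec d =>
        inner ℝ (wt z.1 z.2) (primitive (w 0) wt z.1 z.2))
        ((volume.restrict (Icc 0 T)).prod (volume.restrict U)) := by
      have h2 := h.memLp_deriv.norm.integrable_mul hprim.norm
      refine h2.mono' (h.memLp_deriv.1.inner hprim.1) (ae_of_all _ fun z => ?_)
      exact norm_inner_le_norm _ _
    exact (h1.const_mul 2).bdd_mul hm.comp_snd hCz
  obtain ⟨h1, h2⟩ := integral_sub_eq_integral_fderiv (contDiff_norm_sq ℝ) (m := m)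
    (h.memLp_deriv.integrable one_le_two) h.eq_primitive hk (fun s hs =>
      (h.memLp s hs).norm.integrable_sq.bdd_mul hm hC) ht
  have e : ∀ s, ∫ y in U, m y * fderiv ℝ (fun v : Vec d => ‖v‖ ^ 2) (w s y) (wt s y)
      = 2 * ∫ y in U, m y * inner ℝ (wt s y) (w s y) := by
    intro s
    rw [← integral_const_mul]
    refine integral_congr_ae (ae_of_all _ fun y => ?_)
    simp only [hder]
    ring
  simp only [e] at h1 h2
  refine ⟨?_, h2.trans (intervalIntegral.integral_const_mul _ _)⟩
  simpa using h1.const_mul (1 / 2)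

lemma exists_forall_norm_le_of_continuous {E F : Type*} [NormedAddCommGroup E] [NormedSpace ℝ E]
    [FiniteDimensional ℝ E] [NormedAddCommGroup F] {Φ : E → F} (hΦ : Continuous Φ) (L : ℝ) :
    ∃ C, ∀ A : E, ‖A‖ ≤ L → ‖Φ A‖ ≤ C := by
  have hp : ProperSpace E := FiniteDimensional.proper ℝ E
  obtain ⟨C, hC⟩ := (isCompact_closedBall (0 : E) L).exists_bound_of_continuousOn hΦ.continuousOn
  exact ⟨C, fun A hA => hC A (mem_closedBall_zero_iff.2 hA)⟩

lemma exists_forall_norm_fderiv_le {E : Type*} [NormedAddCommGroup E] [NormedSpace ℝ E]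
    [FiniteDimensional ℝ E] {Φ : E → ℝ} (hΦ : ContDiff ℝ 1 Φ) (L : ℝ) :
    ∃ C, ∀ A : E, ‖A‖ ≤ L → ‖fderiv ℝ Φ A‖ ≤ C :=
  exists_forall_norm_le_of_continuous (hΦ.continuous_fderiv (by simp)) L

lemma aestronglyMeasurable_jacobian {d : ℕ} (f : Vec d → Vec d) (μ : Measure (Vec d)) :
    AEStronglyMeasurable (jacobian f) μ :=
  aestronglyMeasurable_tensor fun i j => (measurable_jacobian_apply f i j).aestronglyMeasurable

namespace Data

variable {d : ℕ} {D : Data d} {u : ℝ → Vec d → Vec d} {p : ℝ → Vec d → ℝ}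
  {x : ℝ → Vec d → Vec d} {Gu : ℝ → Vec d → Tensor d} {ut a : ℝ → Vec d → Vec d}

namespace IsWeakSolution

lemma kineticΩ_sub (h : D.IsWeakSolution u p x Gu ut a) {t : ℝ} (ht : t ∈ Icc 0 D.T) :
    IntervalIntegrable (fun s => ∫ y in D.Ω, inner ℝ (ut s y) (u s y)) volume 0 t ∧
    D.kineticΩ u t - D.kineticΩ u 0
      = D.ρf * ∫ s in 0..t, ∫ y in D.Ω, inner ℝ (ut s y) (u s y) := by
  have := D.isFiniteMeasure_Ω
  obtain ⟨h1, h2⟩ := h.timeDerivative.integral_mul_norm_sq D.T_pos (m := fun _ => 1)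
    aestronglyMeasurable_const (C := 1) (ae_of_all _ fun _ => by simp) ht
  simp only [one_mul] at h1 h2
  refine ⟨h1, ?_⟩
  rw [kineticΩ, kineticΩ, ← mul_sub, h2]
  ring

/-- Integrals over the solid, in reference coordinates. Since the motion is incompressible, the
volume element is the initial one. -/
lemma setIntegral_solid (h : D.IsWeakSolution u p x Gu ut a) {t : ℝ} (ht : t ∈ Icc 0 D.T)
    (g : Vec d → ℝ) :
    ∫ y in x t '' D.ΩX, g y = ∫ X in D.ΩX, |(jacobian (x 0) X).det| * g (x t X) := by
  obtain ⟨L, K, hLK⟩ := h.motion.exists_biLip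
  rw [(hLK t ht).setIntegral_image]
  refine integral_congr_ae ?_
  filter_upwards [h.det_jacobian_eq ht] with X hX
  rw [hX]

lemma kineticSolid_sub (h : D.IsWeakSolution u p x Gu ut a) {t : ℝ} (ht : t ∈ Icc 0 D.T) :
    IntervalIntegrable (fun s => ∫ y in x s '' D.ΩX, inner ℝ (a s y) (u s y)) volume 0 t ∧
    D.kineticSolid u x t - D.kineticSolid u x 0
      = D.ρδ * ∫ s in 0..t, ∫ y in x s '' D.ΩX, inner ℝ (a s y) (u s y) := by
  obtain ⟨L, K, hLK⟩ := h.motion.exists_biLip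
  have hfin := h.motion.isFiniteMeasure_ΩX
  have h0 : (0 : ℝ) ∈ Icc 0 D.T := left_mem_Icc.2 D.T_pos.le
  have hm : AEStronglyMeasurable (fun X => |(jacobian (x 0) X).det|) (volume.restrict D.ΩX) :=
    continuous_abs.comp_aestronglyMeasurable (contDiff_det.continuous.comp_aestronglyMeasurable
      (aestronglyMeasurable_jacobian (x 0) _))
  have hC : ∀ᵐ X ∂(volume.restrict D.ΩX),
      ‖|(jacobian (x 0) X).det|‖
        ≤ (Fintype.card (Fin d)).factorial • (L : ℝ) ^ Fintype.card (Fin d) := by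
    filter_upwards [ae_restrict_mem D.isOpen_ΩX.measurableSet] with X hX
    rw [Real.norm_eq_abs, abs_abs]
    exact Matrix.det_le (abv := AbsoluteValue.abs) fun i j =>
      abs_jacobian_apply_le D.isOpen_ΩX (hLK 0 h0).lipschitz hX i j
  obtain ⟨h1, h2⟩ := h.materialDerivative.integral_mul_norm_sq D.T_pos hm hC ht
  have e : ∀ s ∈ uIoc 0 t, ∫ X in D.ΩX, |(jacobian (x 0) X).det| *
      inner ℝ (a s (x s X)) (u s (x s X)) = ∫ y in x s '' D.ΩX, inner ℝ (a s y) (u s y) := by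
    intro s hs
    rw [uIoc_of_le ht.1] at hs
    exact (h.setIntegral_solid ⟨hs.1.le, hs.2.trans ht.2⟩
      fun y => inner ℝ (a s y) (u s y)).symm
  refine ⟨h1.congr e, ?_⟩
  rw [← intervalIntegral.integral_congr_ae (ae_of_all _ e), kineticSolid, kineticSolid, solid,
    solid, h.setIntegral_solid ht, h.setIntegral_solid h0, ← mul_sub, h2]
  ring

lemma integrableOn_energy (h : D.IsWeakSolution u p x Gu ut a) {t : ℝ} (ht : t ∈ Icc 0 D.T) :
    IntegrableOn (fun X => D.Ψ (jacobian (x t) X)) D.ΩX := by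
  obtain ⟨L, K, hLK⟩ := h.motion.exists_biLip
  have hfin := h.motion.isFiniteMeasure_ΩX
  obtain ⟨C, hC⟩ := exists_forall_norm_le_of_continuous D.contDiff_Ψ.continuous L
  refine Integrable.of_bound (C := C)
    (D.contDiff_Ψ.continuous.comp_aestronglyMeasurable (aestronglyMeasurable_jacobian (x t) _)) ?_
  filter_upwards [ae_restrict_mem D.isOpen_ΩX.measurableSet] with X hX
  exact hC _ (norm_jacobian_le D.isOpen_ΩX (hLK t ht).lipschitz hX)

/-- The rate of change of the potential energy is the power `∫ P(F) : ∇_X u` of the elastic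
stress. -/
lemma potential_sub (h : D.IsWeakSolution u p x Gu ut a) {t : ℝ} (ht : t ∈ Icc 0 D.T) :
    IntervalIntegrable (fun s => ∫ X in D.ΩX, ddot (piolaKirchhoff D.Ψ (jacobian (x s) X))
      (Gu s (x s X) * jacobian (x s) X)) volume 0 t ∧
    D.potential x t - D.potential x 0
      = ∫ s in 0..t, ∫ X in D.ΩX, ddot (piolaKirchhoff D.Ψ (jacobian (x s) X))
        (Gu s (x s X) * jacobian (x s) X) := by
  obtain ⟨L, K, hLK⟩ := h.motion.exists_biLip
  have hfin := h.motion.isFiniteMeasure_ΩX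
  have h0 : (0 : ℝ) ∈ Icc 0 D.T := left_mem_Icc.2 D.T_pos.le
  obtain ⟨H, hH, hHx⟩ := h.exists_velocityGradient
  have hHi := integrable_of_memLp_two hH
  have hprim : ∀ s ∈ Icc 0 D.T,
      jacobian (x s) =ᵐ[volume.restrict D.ΩX] primitive (jacobian (x 0)) H s :=
    fun s hs => h.jacobian_eq_primitive hH hHx hs
  have hcont : Continuous (fderiv ℝ D.Ψ) := D.contDiff_Ψ.continuous_fderiv (by simp)
  obtain ⟨C, hC⟩ := exists_forall_norm_fderiv_le D.contDiff_Ψ L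
  have hPm : AEStronglyMeasurable (fun z : ℝ × Vec d => primitive (jacobian (x 0)) H z.1 z.2)
      ((volume.restrict (Icc 0 D.T)).prod (volume.restrict D.ΩX)) :=
    aestronglyMeasurable_primitive (aestronglyMeasurable_jacobian (x 0) _) hH.1
  -- The bound `‖F‖ ≤ L` holds at each time; written as an equality of jointly measurable functions,
  -- it holds almost everywhere in space-time.
  have hPb : (fun z : ℝ × Vec d => max ‖primitive (jacobian (x 0)) H z.1 z.2‖ (L : ℝ))
      =ᵐ[(volume.restrict (Icc 0 D.T)).prod (volume.restrict D.ΩX)] fun _ => (L : ℝ) := by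
    refine ae_eq_prod_of_ae_ae
      ((continuous_id.max continuous_const).comp_aestronglyMeasurable hPm.norm)
      aestronglyMeasurable_const ?_
    filter_upwards [ae_mem_Icc] with s hs
    filter_upwards [hprim s hs, ae_restrict_mem D.isOpen_ΩX.measurableSet] with X h1 h2
    rw [← h1]
    exact max_eq_right (norm_jacobian_le D.isOpen_ΩX (hLK s hs).lipschitz h2)
  have hk : Integrable (fun z : ℝ × Vec d =>
      (1 : ℝ) * fderiv ℝ D.Ψ (primitive (jacobian (x 0)) H z.1 z.2) (H z.1 z.2))
      ((volume.restrict (Icc 0 D.T)).prod (volume.restrict D.ΩX)) := by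
    simp only [one_mul]
    refine (hHi.norm.const_mul C).mono'
      (isBoundedBilinearMap_apply.continuous.comp_aestronglyMeasurable
        ((hcont.comp_aestronglyMeasurable hPm).prodMk hH.1)) ?_
    filter_upwards [hPb] with z hz
    refine (ContinuousLinearMap.le_opNorm _ _).trans
      (mul_le_mul_of_nonneg_right (hC _ (max_eq_right_iff.1 hz)) (norm_nonneg _))
  obtain ⟨h1, h2⟩ := integral_sub_eq_integral_fderiv (Φ := D.Ψ) D.contDiff_Ψ (m := fun _ => 1)
    (w := fun s => jacobian (x s)) (wt := H) hHi hprim hk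
    (fun s hs => by simp only [one_mul]; exact h.integrableOn_energy hs) ht
  simp only [one_mul] at h1 h2
  have e : ∀ᵐ s ∂(volume.restrict (uIoc 0 t)),
      ∫ X in D.ΩX, fderiv ℝ D.Ψ (jacobian (x s) X) (H s X)
        = ∫ X in D.ΩX, ddot (piolaKirchhoff D.Ψ (jacobian (x s) X))
          (Gu s (x s X) * jacobian (x s) X) := by
    rw [uIoc_of_le ht.1]
    filter_upwards [ae_restrict_of_ae_restrict_of_subset
      (Ioc_subset_Icc_self.trans (Icc_subset_Icc_right ht.2)) hHx] with s hs
    refine integral_congr_ae ?_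
    filter_upwards [hs] with X hX
    rw [ddot_piolaKirchhoff, hX]
  refine ⟨h1.congr_ae e, ?_⟩
  rw [potential, potential, h2]
  exact intervalIntegral.integral_congr_ae_restrict e

lemma intervalIntegrable_dissipation (h : D.IsWeakSolution u p x Gu ut a) {t : ℝ}
    (ht : t ∈ Icc 0 D.T) :
    IntervalIntegrable (fun s => ∫ y in D.Ω, ddot (symGrad (Gu s y)) (symGrad (Gu s y)))
      volume 0 t := by
  have := D.isFiniteMeasure_Ω
  refine ae_intervalIntegrable_integral
    (k := fun s y => ddot (symGrad (Gu s y)) (symGrad (Gu s y))) ?_ ht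
  have h1 : ∀ i j, MemLp (fun z : ℝ × Vec d => symGrad (Gu z.1 z.2) i j) 2
      ((volume.restrict (Icc 0 D.T)).prod (volume.restrict D.Ω)) := fun i j =>
    (h.gradient_memLp i j).add (h.gradient_memLp j i)
  exact integrable_finsetSum _ fun i _ => integrable_finsetSum _ fun j _ =>
    (h1 i j).integrable_mul (h1 i j)

/-- The balance of power: the momentum equation tested with the velocity itself. -/
lemma ae_power_balance (hd : d = 2 ∨ d = 3) (h : D.IsWeakSolution u p x Gu ut a) :
    ∀ᵐ t ∂(volume.restrict (Icc 0 D.T)),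
      D.ρf * (∫ y in D.Ω, inner ℝ (ut t y) (u t y))
      + D.νf / 2 * (∫ y in D.Ω, ddot (symGrad (Gu t y)) (symGrad (Gu t y)))
      + D.ρδ * (∫ y in x t '' D.ΩX, inner ℝ (a t y) (u t y))
      + D.νδ / 2 * (∫ y in x t '' D.ΩX, ddot (symGrad (Gu t y)) (symGrad (Gu t y)))
      + (∫ X in D.ΩX, ddot (piolaKirchhoff D.Ψ (jacobian (x t) X))
          (Gu t (x t X) * jacobian (x t) X)) = 0 := by
  obtain ⟨L, K, hLK⟩ := h.motion.exists_biLip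
  filter_upwards [h.velocity_mem, h.pressure_mem, h.momentum, h.incompressible,
    h.ae_trace_eq_zero, ae_mem_Icc] with t h1 h2 h3 h4 h5 h6
  have h7 := h3 (u t) (Gu t) _ h1 (h1.comp_biLip (hLK t h6))
  have h8 := h1.integral_convective_eq_zero hd D.bounded_Ω h5
  have h9 := neg_eq_zero.1 (h4 (p t) h2.memLp)
  rw [MomentumEq, h8, h9] at h7
  linarith

/-- The energy balance, by integrating the balance of power in time. The power dissipated in the
solid is integrable in time because the balance expresses it through the other, integrable, terms.
-/
lemma energy_eq (hd : d = 2 ∨ d = 3) (h : D.IsWeakSolution u p x Gu ut a) {t : ℝ}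
    (ht : t ∈ Icc 0 D.T) :
    D.kineticΩ u t + D.dissipationΩ Gu t + D.kineticSolid u x t + D.dissipationSolid Gu x t
        + D.potential x t
      = D.kineticΩ u 0 + D.kineticSolid u x 0 + D.potential x 0 := by
  obtain ⟨hA, eA⟩ := h.kineticΩ_sub ht
  obtain ⟨hC, eC⟩ := h.kineticSolid_sub ht
  obtain ⟨hE, eE⟩ := h.potential_sub ht
  have hB := h.intervalIntegrable_dissipation ht
  have hS : D.dissipationSolid Gu x t
      = ∫ s in 0..t, (-(D.ρf * (∫ y in D.Ω, inner ℝ (ut s y) (u s y))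
        + D.νf / 2 * (∫ y in D.Ω, ddot (symGrad (Gu s y)) (symGrad (Gu s y)))
        + D.ρδ * (∫ y in x s '' D.ΩX, inner ℝ (a s y) (u s y))
        + (∫ X in D.ΩX, ddot (piolaKirchhoff D.Ψ (jacobian (x s) X))
          (Gu s (x s X) * jacobian (x s) X)))) := by
    rw [dissipationSolid, ← intervalIntegral.integral_const_mul]
    refine intervalIntegral.integral_congr_ae_restrict ?_
    rw [uIoc_of_le ht.1]
    filter_upwards [ae_restrict_of_ae_restrict_of_subset
      (Ioc_subset_Icc_self.trans (Icc_subset_Icc_right ht.2)) (h.ae_power_balance hd)] with s hs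
    simp only [solid]
    linarith
  rw [intervalIntegral.integral_neg, intervalIntegral.integral_add
      (((hA.const_mul _).add (hB.const_mul _)).add (hC.const_mul _)) hE,
    intervalIntegral.integral_add ((hA.const_mul _).add (hB.const_mul _)) (hC.const_mul _),
    intervalIntegral.integral_add (hA.const_mul _) (hB.const_mul _),
    intervalIntegral.integral_const_mul, intervalIntegral.integral_const_mul,
    intervalIntegral.integral_const_mul] at hS
  rw [hS, dissipationΩ]
  linarith

end IsWeakSolution

end Data

end FSI


theorem mainTheorem5 {d : ℕ} (hd : d = 2 ∨ d = 3) (D : FSI.Data d)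
    (u : ℝ → FSI.Vec d → FSI.Vec d) (p : ℝ → FSI.Vec d → ℝ) (x : ℝ → FSI.Vec d → FSI.Vec d)
    (Gu : ℝ → FSI.Vec d → FSI.Tensor d) (ut a : ℝ → FSI.Vec d → FSI.Vec d)
    (h : D.IsWeakSolution u p x Gu ut a) :
    (∀ t ∈ Set.Icc 0 D.T,
      MeasureTheory.IntegrableOn (fun X => D.Ψ (FSI.jacobian (x t) X)) D.ΩX ∧
      D.kineticΩ u t + D.dissipationΩ Gu t + D.kineticSolid u x t + D.dissipationSolid Gu x t
          + D.potential x t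
        = D.kineticΩ u 0 + D.kineticSolid u x 0 + D.potential x 0) ∧
    (D.kineticΩ u 0 + D.kineticSolid u x 0 + D.potential x 0 = 0 →
      ∀ t ∈ Set.Icc 0 D.T,
        D.kineticΩ u t + D.dissipationΩ Gu t + D.kineticSolid u x t + D.dissipationSolid Gu x t
          + D.potential x t = 0) := by
  have key := fun t (ht : t ∈ Set.Icc 0 D.T) => h.energy_eq hd ht
  exact ⟨fun t ht => ⟨h.integrableOn_energy ht, key t ht⟩, fun h0 t ht => (key t ht).trans h0⟩
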